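/- Let $G=(V,E)$ be a finite simple graph with edge weights $w\in\mathbb R^E_{\ge 0}$. A \emph{fractional matching} of $G$ is a feasible solution of the linear program $$\nu_f(G)=\max\{\,w^\top x : x(\delta(v))\le 1 \text{ for all } v\in V,\ x\ge 0\,\},\qquad x\in\mathbb R^E,$$ where $\delta(v)$ is the set of edges incident to $v$ and $x(F)=\sum_{e\in F}x_e$; it is \emph{basic} if it is a basic feasible solution of this program, and \emph{maximum-weight} if it attains the maximum. For a basic fractional matching $x$ let $\mathscr C(x)$ be the set of odd cycles $C$ of $G$ with $x_e=\tfrac12$ for every edge $e$ of $C$, and let $$\gamma(G)=\min\{\,|\mathscr C(x)| : x \text{ is a basic maximum-weight fractional matching of } G\,\}.$$ Let $\nu(G)$ be the maximum weight of a matching of $G$. The weighted graph $G$ is \emph{stable} if $\nu(G)=\nu_f(G)$. For $S\subseteq V$ let $G\setminus S=G[V\setminus S]$ with the inherited weights, and call $S$ a \emph{vertex-stabilizer} of $G$ if $G\setminus S$ is stable. Then: 1. for every vertex $v\in V$, $\gamma(G\setminus v)\ge\gamma(G)-1$, where $G\setminus v=G\setminus\{v\}$; 2. every vertex-stabilizer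 $S$ of $G$ satisfies $|S|\ge\gamma(G)$. -/

import Mathlib

/-! A weighted graph is a simple graph `G` on a finite vertex set `V` together with `w : Sym2 V → ℝ`.
Only the values of `w` on the edges of `G` ever enter; they are required to be nonnegative.
All sums `∑ᶠ` below are finite sums, because `V` is finite. -/

namespace WGraph

variable {V : Type*}

/-- `δ(v)`: the edges of `G` incident to `v`. -/
def delta (G : SimpleGraph V) (v : V) : Set G.edgeSet := {e | v ∈ (e : Sym2 V)}

/-- The value `wᵀ x` of a vector `x ∈ ℝ^E`. -/
noncomputable def value (G : SimpleGraph V) (w : Sym2 V → ℝ) (x : G.edgeSet → ℝ) : ℝ :=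
  ∑ᶠ e : G.edgeSet, w e * x e

/-- Fractional matchings: feasible solutions of
`max { wᵀ x : x(δ(v)) ≤ 1 for all v ∈ V, x ≥ 0 }`. -/
def IsFractionalMatching (G : SimpleGraph V) (x : G.edgeSet → ℝ) : Prop :=
  (∀ e, 0 ≤ x e) ∧ ∀ v, ∑ᶠ e ∈ delta G v, x e ≤ 1

/-- `ν_f(G)`, the value of a maximum-weight fractional matching. -/
noncomputable def nuF (G : SimpleGraph V) (w : Sym2 V → ℝ) : ℝ :=
  sSup {r | ∃ x, IsFractionalMatching G x ∧ r = value G w x}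

/-- `ν(G)`, the value of a maximum-weight matching. -/
noncomputable def nu (G : SimpleGraph V) (w : Sym2 V → ℝ) : ℝ :=
  sSup {r | ∃ M : G.Subgraph, M.IsMatching ∧ r = ∑ᶠ e ∈ M.edgeSet, w e}

/-- A weighted graph is stable if `ν(G) = ν_f(G)`. -/
def IsStable (G : SimpleGraph V) (w : Sym2 V → ℝ) : Prop :=
  nu G w = nuF G w

/-- Basic fractional matchings, i.e. basic feasible solutions of the linear program: feasible
points at which the coefficient vectors of the tight constraints (`x(δ(v)) ≤ 1`, whose vector is
the indicator of `δ(v)`, and `x_e ≥ 0`, whose vector is the unit vector of `e`) span `ℝ^E`. -/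
def IsBasic (G : SimpleGraph V) (x : G.edgeSet → ℝ) : Prop :=
  IsFractionalMatching G x ∧
    Submodule.span ℝ
      ({a | ∃ v, ∑ᶠ e ∈ delta G v, x e = 1 ∧ a = Set.indicator (delta G v) 1} ∪
        {a | ∃ e, x e = 0 ∧ a = Set.indicator {e} 1} : Set (G.edgeSet → ℝ)) = ⊤

/-- Basic maximum-weight fractional matchings. -/
def IsBasicMax (G : SimpleGraph V) (w : Sym2 V → ℝ) (x : G.edgeSet → ℝ) : Prop :=
  IsBasic G x ∧ ∀ x', IsFractionalMatching G x' → value G w x' ≤ value G w x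

/-- `𝒞(x)`: the odd cycles of `G` all of whose edges `e` have `x_e = 1/2`.
A cycle is identified with its edge set. -/
def oddCycles (G : SimpleGraph V) (x : G.edgeSet → ℝ) : Set (Set G.edgeSet) :=
  {C | (∀ e ∈ C, x e = 1 / 2) ∧
    ∃ (u : V) (p : G.Walk u u), p.IsCycle ∧ Odd p.length ∧ C = {e | (e : Sym2 V) ∈ p.edges}}

/-- `γ(G)`: the minimum of `|𝒞(x)|` over all basic maximum-weight fractional matchings `x`.
This minimum is over a nonempty set, see `exists_isBasicMax`. -/
noncomputable def gamma (G : SimpleGraph V) (w : Sym2 V → ℝ) : ℕ :=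
  sInf {k | ∃ x, IsBasicMax G w x ∧ k = (oddCycles G x).ncard}

/-- The vertex-deleted graph `G ∖ S = G[V ∖ S]`. -/
abbrev deleteVerts (G : SimpleGraph V) (S : Set V) : SimpleGraph (Sᶜ : Set V) :=
  G.induce Sᶜ

/-- The edge weights inherited by `G ∖ S`. -/
def deleteWeight (w : Sym2 V → ℝ) (S : Set V) : Sym2 (Sᶜ : Set V) → ℝ :=
  fun e => w (e.map Subtype.val)

/-- `S` is a vertex-stabilizer if `G ∖ S` is stable. -/
def IsVertexStabilizer (G : SimpleGraph V) (w : Sym2 V → ℝ) (S : Set V) : Prop :=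
  IsStable (deleteVerts G S) (deleteWeight w S)

theorem isFractionalMatching_iff_sum [Finite V] (G : SimpleGraph V) [Fintype G.edgeSet]
    [∀ v, DecidablePred (· ∈ delta G v)] (x : G.edgeSet → ℝ) :
    IsFractionalMatching G x ↔
      (∀ e, 0 ≤ x e) ∧ ∀ v, ∑ e, Set.indicator (delta G v) x e ≤ 1 := by
  have h : ∀ v, ∑ᶠ e ∈ delta G v, x e = ∑ e, Set.indicator (delta G v) x e := fun v => by
    rw [finsum_mem_def, finsum_eq_sum_of_fintype]
  simp only [IsFractionalMatching, h]

/-- Basic maximum-weight fractional matchings exist, so that `γ` is a genuine minimum. -/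
theorem exists_isBasicMax [Finite V] (G : SimpleGraph V) (w : Sym2 V → ℝ) :
    ∃ x, IsBasicMax G w x := by
  classical
  have := Fintype.ofFinite V
  let P : Set (G.edgeSet → ℝ) := {x | IsFractionalMatching G x}
  have hP : P = {x | (∀ e, 0 ≤ x e) ∧ ∀ v, ∑ e, Set.indicator (delta G v) x e ≤ 1} := by
    ext x; exact isFractionalMatching_iff_sum G x
  have hind : ∀ (v : V) (e : G.edgeSet),
      Continuous fun x : G.edgeSet → ℝ => Set.indicator (delta G v) x e := by
    intro v e
    by_cases h : e ∈ delta G v <;> simp only [Set.indicator, h, if_true, if_false] <;> fun_prop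
  have hcl : IsClosed P := by
    rw [hP, Set.ofPred_and, Set.ofPred_forall, Set.ofPred_forall]
    refine (isClosed_iInter fun e => isClosed_le continuous_const (continuous_apply e)).inter
      (isClosed_iInter fun v => isClosed_le (continuous_finsetSum _ fun e _ => hind v e)
        continuous_const)
  have hsub : P ⊆ Set.Icc 0 1 := by
    intro x hx
    rw [hP] at hx
    refine ⟨fun e => hx.1 e, fun e => ?_⟩
    obtain ⟨v, hv⟩ : ∃ v, v ∈ (e : Sym2 V) := ⟨_, Sym2.out_fst_mem _⟩
    refine le_trans ?_ (hx.2 v)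
    have h1 : x e = Set.indicator (delta G v) x e := by
      rw [Set.indicator_of_mem]; exact hv
    rw [h1]
    exact Finset.single_le_sum (f := fun e => Set.indicator (delta G v) x e)
      (fun i _ => Set.indicator_nonneg (fun j _ => hx.1 j) i) (Finset.mem_univ e)
  have hcomp : IsCompact P := isCompact_Icc.of_isClosed_subset hcl hsub
  have hval : ∀ x, value G w x = ∑ e : G.edgeSet, w e * x e := fun x => by
    simp only [value, finsum_eq_sum_of_fintype]
  have hvc : Continuous (value G w) := by
    have : value G w = fun x => ∑ e : G.edgeSet, w e * x e := funext hval
    rw [this]; fun_prop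
  have h0 : (0 : G.edgeSet → ℝ) ∈ P := by rw [hP]; simp
  obtain ⟨x₀, hx₀, hmax⟩ := hcomp.exists_isMaxOn ⟨0, h0⟩ hvc.continuousOn
  let F : Set (G.edgeSet → ℝ) := P ∩ {x | value G w x = value G w x₀}
  have hF : IsCompact F := hcomp.inter_right (isClosed_eq hvc continuous_const)
  obtain ⟨x, hx⟩ := hF.extremePoints_nonempty ⟨x₀, hx₀, rfl⟩
  have hxF : x ∈ F := hx.1
  have hxmax : ∀ x', x' ∈ P → value G w x' ≤ value G w x := by
    intro x' h'
    rw [hxF.2]; exact hmax h'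
  refine ⟨x, ⟨hxF.1, ?_⟩, hxmax⟩
  by_contra hne
  obtain ⟨f, hf0, hf⟩ := Submodule.exists_le_ker_of_lt_top _ (lt_top_iff_ne_top.mpr hne)
  let d : G.edgeSet → ℝ := fun e => f (Pi.single e 1)
  have hfd : ∀ a, f a = ∑ e, a e * d e := by
    intro a
    conv_lhs => rw [pi_eq_sum_univ' a]
    simp [d, map_sum, Pi.single]
  have hxP : (∀ e, 0 ≤ x e) ∧ ∀ v, ∑ e, Set.indicator (delta G v) x e ≤ 1 := by
    have := hxF.1; rw [hP] at this; exact this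
  have hde : ∀ e, x e = 0 → d e = 0 := by
    intro e he
    have h := hf (Submodule.subset_span (Or.inr ⟨e, he, rfl⟩))
    rw [LinearMap.mem_ker, hfd] at h
    simpa [Set.indicator_apply] using h
  have hdv : ∀ v, ∑ e, Set.indicator (delta G v) x e = 1 →
      ∑ e, Set.indicator (delta G v) d e = 0 := by
    intro v hv
    have h := hf (Submodule.subset_span
      (Or.inl ⟨v, by rw [finsum_mem_def, finsum_eq_sum_of_fintype]; exact hv, rfl⟩))
    rw [LinearMap.mem_ker, hfd] at h
    rw [← h]
    refine Finset.sum_congr rfl fun e _ => ?_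
    by_cases he : e ∈ delta G v <;> simp [he]
  have hadd : ∀ (t : ℝ) (v : V), ∑ e, Set.indicator (delta G v) (x + t • d) e =
      ∑ e, Set.indicator (delta G v) x e + t * ∑ e, Set.indicator (delta G v) d e := by
    intro t v
    rw [Finset.mul_sum, ← Finset.sum_add_distrib]
    refine Finset.sum_congr rfl fun e _ => ?_
    by_cases he : e ∈ delta G v <;> simp [he]
  have hev : ∀ᶠ t : ℝ in nhds 0, x + t • d ∈ P := by
    rw [hP]
    refine Filter.Eventually.and ?_ ?_
    · refine Filter.eventually_all.mpr fun e => ?_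
      rcases (hxP.1 e).eq_or_lt with h | h
      · exact Filter.Eventually.of_forall fun t => by simp [← h, hde e h.symm]
      · have hc : Continuous fun t : ℝ => (x + t • d) e := by
          simp only [Pi.add_apply, Pi.smul_apply, smul_eq_mul]; fun_prop
        have := (hc.tendsto 0).eventually_const_lt (u := 0) (by simpa using h)
        exact this.mono fun t ht => ht.le
    · refine Filter.eventually_all.mpr fun v => ?_
      simp only [hadd]
      rcases (hxP.2 v).eq_or_lt with h | h
      · exact Filter.Eventually.of_forall fun t => by rw [hdv v h, h]; simp
      · have hc : Continuous fun t : ℝ => ∑ e, Set.indicator (delta G v) x e +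
            t * ∑ e, Set.indicator (delta G v) d e := by fun_prop
        have := (hc.tendsto 0).eventually_lt_const (u := 1) (by simpa using h)
        exact this.mono fun t ht => ht.le
  have hev' : ∀ᶠ t : ℝ in nhds 0, x + (-t) • d ∈ P := by
    have : Filter.Tendsto (fun t : ℝ => -t) (nhds 0) (nhds 0) := by
      simpa using (continuous_neg (G := ℝ)).tendsto 0
    exact this.eventually hev
  obtain ⟨ε, hε, hball⟩ := Metric.eventually_nhds_iff.mp (hev.and hev')
  obtain ⟨h1, h2⟩ := hball (y := ε / 2) (by
    rw [Real.dist_eq, sub_zero, abs_of_pos (by positivity)]; linarith)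
  have hvadd : ∀ t : ℝ, value G w (x + t • d) = value G w x + t * value G w d := by
    intro t
    rw [hval, hval, hval, Finset.mul_sum, ← Finset.sum_add_distrib]
    refine Finset.sum_congr rfl fun e _ => ?_
    simp only [Pi.add_apply, Pi.smul_apply, smul_eq_mul]; ring
  have e1 := hxmax _ h1
  have e2 := hxmax _ h2
  rw [hvadd] at e1 e2
  have hz : (ε / 2) * value G w d = 0 := by linarith
  have m1 : x + (ε / 2) • d ∈ F := ⟨h1, by
    rw [Set.mem_ofPred_eq, hvadd, hz, add_zero]; exact hxF.2⟩
  have m2 : x + (-(ε / 2)) • d ∈ F := ⟨h2, by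
    rw [Set.mem_ofPred_eq, hvadd, neg_mul, hz, neg_zero, add_zero]; exact hxF.2⟩
  have hseg : x ∈ openSegment ℝ (x + (ε / 2) • d) (x + (-(ε / 2)) • d) :=
    ⟨1 / 2, 1 / 2, by norm_num, by norm_num, by norm_num, by module⟩
  have := hx.2 m1 m2 hseg
  have hd : d = 0 := by
    have h3 : (ε / 2) • d = 0 := by simpa using this
    exact (smul_eq_zero.mp h3).resolve_left (by positivity)
  apply hf0
  ext e
  rw [LinearMap.zero_comp, LinearMap.comp_apply]
  simpa [d] using congrFun hd e

end WGraph

/-! By linear programming duality and a rank argument, `γ(G)` is governed by pairs of a basic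
fractional matching and a fractional vertex cover satisfying complementary slackness. By
Birkhoff's theorem a basic fractional matching comes from a permutation of `V`: its transpositions
are edges of value `1`, its longer cycles are odd cycles of value `1/2`.

Let `X` be a basic optimal fractional matching of `G ∖ v` and give `v` a large dual value. Among the
covers of `G` that satisfy complementary slackness with `X` everywhere except at `v`, take one with
the least value at `v`. Search along alternating paths of tight edges, starting at `v` and staying
in the matching part of `X`. If the search were to get stuck, the usual dual step of the Hungarian
method would lower the value at `v`. So it reaches a vertex of dual value `0`, another exposed
vertex, an odd cycle of `X`, or it closes up to a new odd cycle. In every case one obtains an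
optimal fractional matching of `G` whose support, up to a single edge, consists of the old odd
cycles and of two matchings on the remaining vertices. Two matchings contain no odd cycle, and the
odd cycles of value `1/2` through a given edge coincide, so at most one odd cycle is new. Hence
`γ(G) ≤ γ(G ∖ v) + 1`, and a stable graph has `γ = 0` because a maximum-weight matching is a basic
optimal fractional matching without edges of value `1/2`. -/

namespace WGraph

open Function Finset

/-! ### Fractional matchings and linear programming duality -/

section FractionalMatching

variable {V : Type*} {G : SimpleGraph V}

lemma exists_domRestrict_edgeSet_eq (x : G.edgeSet → ℝ) :
    ∃ X : Sym2 V → ℝ, support X ⊆ G.edgeSet ∧ G.edgeSet.domRestrict X = x := by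
  refine ⟨extend Subtype.val x 0, support_extend_zero_subset.trans ?_, ?_⟩
  · rintro _ ⟨e, -, rfl⟩
    exact e.2
  · ext e
    exact Subtype.val_injective.extend_apply x 0 e

lemma span_eq_top_iff_forall_dotProduct {ι : Type*} [Fintype ι] {A : Set (ι → ℝ)} :
    Submodule.span ℝ A = ⊤ ↔ ∀ d : ι → ℝ, (∀ a ∈ A, d ⬝ᵥ a = 0) → d = 0 := by
  classical
  refine ⟨fun h d hd => dotProduct_eq_zero_iff.mp fun b => ?_, fun h => ?_⟩
  · have hle : Submodule.span ℝ A ≤ (dotProductEquiv ℝ ι d).ker := Submodule.span_le.mpr hd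
    exact hle (h ▸ Submodule.mem_top : b ∈ Submodule.span ℝ A)
  · by_contra hne
    obtain ⟨f, hf, hle⟩ := Submodule.exists_le_ker_of_lt_top _ (lt_top_iff_ne_top.mpr hne)
    obtain ⟨d, rfl⟩ := (dotProductEquiv ℝ ι).surjective f
    exact hf (by rw [h d fun a ha => hle (Submodule.subset_span ha), map_zero])

lemma single_one_nonneg [DecidableEq V] (e e' : Sym2 V) : 0 ≤ (Pi.single e 1 : Sym2 V → ℝ) e' :=
  (Pi.single_nonneg.mpr zero_le_one : (0 : Sym2 V → ℝ) ≤ Pi.single e 1) e'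

variable [Fintype V] {w X : Sym2 V → ℝ} {y : V → ℝ}

/-- The load `X(δ(a))` which a vector `X` indexed by unordered pairs puts on the vertex `a`. A loop
counts once; the vectors of interest vanish off the edge set of a simple graph. -/
def degree (a : V) : (Sym2 V → ℝ) →ₗ[ℝ] ℝ :=
  ∑ b, LinearMap.proj s(a, b)

lemma degree_apply (a : V) (X : Sym2 V → ℝ) : degree a X = ∑ b, X s(a, b) := by
  simp [degree]

lemma degree_single [DecidableEq V] {p q : V} (hpq : p ≠ q) (a : V) :
    degree a (Pi.single s(p, q) 1) = (if a = p then 1 else 0) + if a = q then 1 else 0 := by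
  have hterm (b : V) : (Pi.single s(p, q) 1 : Sym2 V → ℝ) s(a, b) =
      (if a = p then if b = q then 1 else 0 else 0) +
        if a = q then if b = p then 1 else 0 else 0 := by
    simp only [Pi.single_apply, Sym2.eq_iff]
    split_ifs <;> grind
  simp only [degree_apply, hterm, sum_add_distrib]
  split_ifs <;> simp

/-- A fractional matching of `G`, as a vector indexed by all unordered pairs of vertices that
vanishes off the edges of `G`. -/
structure IsFracVec (G : SimpleGraph V) (X : Sym2 V → ℝ) : Prop where
  nonneg : ∀ e, 0 ≤ X e
  support_subset : support X ⊆ G.edgeSet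
  degree_le : ∀ a, degree a X ≤ 1

/-- The constraints that are tight at `X` determine `X`: no nonzero direction preserves all of
them. For fractional matchings this says that `X` is basic. -/
def IsRigid (X : Sym2 V → ℝ) : Prop :=
  ∀ D : Sym2 V → ℝ, (∀ e, X e = 0 → D e = 0) → (∀ a, degree a X = 1 → degree a D = 0) → D = 0

lemma IsFracVec.adj (hX : IsFracVec G X) {a b : V} (h : X s(a, b) ≠ 0) : G.Adj a b :=
  hX.support_subset h

lemma IsFracVec.mono {H : SimpleGraph V} (hX : IsFracVec H X) (hHG : H ≤ G) : IsFracVec G X :=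
  ⟨hX.nonneg, hX.support_subset.trans (SimpleGraph.edgeSet_mono hHG), hX.degree_le⟩

lemma finsum_delta_domRestrict (hX : support X ⊆ G.edgeSet) (v : V) :
    ∑ᶠ e ∈ delta G v, G.edgeSet.domRestrict X e = degree v X := by
  have hinj : Injective fun b => s(v, b) := fun b c h => Sym2.congr_right.mp h
  calc ∑ᶠ e ∈ delta G v, X e
      = ∑ᶠ e ∈ Subtype.val '' delta G v, X e :=
        (finsum_mem_image Subtype.val_injective.injOn).symm
    _ = ∑ᶠ e ∈ Set.range fun b => s(v, b), X e := by
        refine finsum_mem_inter_support_eq' _ _ _ fun e he => ⟨?_, ?_⟩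
        · rintro ⟨e, hv, rfl⟩
          exact ⟨_, Sym2.other_spec hv⟩
        · rintro ⟨b, rfl⟩
          exact ⟨⟨_, hX he⟩, Sym2.mem_mk_left v b, rfl⟩
    _ = degree v X := by
        rw [finsum_mem_range hinj, finsum_eq_sum_of_fintype, degree_apply]

lemma isFractionalMatching_domRestrict_iff (hX : support X ⊆ G.edgeSet) :
    IsFractionalMatching G (G.edgeSet.domRestrict X) ↔ IsFracVec G X := by
  simp only [IsFractionalMatching, finsum_delta_domRestrict hX]
  refine ⟨fun h => ⟨fun e => ?_, hX, h.2⟩, fun h => ⟨fun e => h.nonneg e, h.degree_le⟩⟩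
  by_cases he : X e = 0
  · exact he.ge
  · exact h.1 ⟨e, hX he⟩

lemma isBasic_domRestrict_iff (hX : support X ⊆ G.edgeSet) :
    IsBasic G (G.edgeSet.domRestrict X) ↔ IsFracVec G X ∧ IsRigid X := by
  classical
  have hdelta (D : Sym2 V → ℝ) (hD : support D ⊆ G.edgeSet) (v : V) :
      G.edgeSet.domRestrict D ⬝ᵥ Set.indicator (delta G v) 1 = degree v D := by
    rw [← finsum_delta_domRestrict hD, finsum_mem_def, finsum_eq_sum_of_fintype]
    exact sum_congr rfl fun e _ => by by_cases he : e ∈ delta G v <;> simp [he]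
  have hunit (d : G.edgeSet → ℝ) (e : G.edgeSet) : d ⬝ᵥ Set.indicator {e} 1 = d e := by
    simp [dotProduct, Set.indicator_apply]
  rw [IsBasic, isFractionalMatching_domRestrict_iff hX, span_eq_top_iff_forall_dotProduct]
  refine and_congr_right fun _ => ⟨fun h D hD₀ hD₁ => ?_, fun h d hd => ?_⟩
  · have hD : support D ⊆ G.edgeSet := fun e he => hX (mt (hD₀ e) he)
    have hzero : G.edgeSet.domRestrict D = 0 := h _ <| by
      rintro _ (⟨v, hv, rfl⟩ | ⟨e, he, rfl⟩)
      · rw [hdelta D hD, hD₁ v (by rwa [← finsum_delta_domRestrict hX])]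
      · rw [hunit]
        exact hD₀ e he
    ext e
    by_cases he : e ∈ G.edgeSet
    · exact congrFun hzero ⟨e, he⟩
    · exact hD₀ e (notMem_support.mp (mt (@hX e) he))
  · obtain ⟨D, hD, rfl⟩ := exists_domRestrict_edgeSet_eq d
    rw [h D (fun e he => ?_) fun v hv => ?_]
    · rfl
    · by_cases heG : e ∈ G.edgeSet
      · rw [← hd _ (Or.inr ⟨⟨e, heG⟩, he, rfl⟩), hunit]
        rfl
      · exact notMem_support.mp (mt (@hD e) heG)
    · rw [← hdelta D hD, hd _ (Or.inl ⟨v, by rwa [finsum_delta_domRestrict hX], rfl⟩)]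

/-- A feasible solution of the linear program dual to fractional matching: nonnegative vertex
values such that the ends of every edge pay for its weight. -/
structure IsCover (G : SimpleGraph V) (w : Sym2 V → ℝ) (y : V → ℝ) : Prop where
  nonneg : ∀ a, 0 ≤ y a
  le_add : ∀ a b, G.Adj a b → w s(a, b) ≤ y a + y b

/-- Complementary slackness between `X` and `y`, where the vertices of `S` are exempt from being
saturated. -/
structure IsSlackOff (w X : Sym2 V → ℝ) (S : Set V) (y : V → ℝ) : Prop where
  tight : ∀ a b, X s(a, b) ≠ 0 → w s(a, b) = y a + y b
  saturated : ∀ a ∉ S, y a ≠ 0 → degree a X = 1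

/-- A primal and a dual feasible solution that certify the optimality of each other. -/
structure IsOptimalPair (G : SimpleGraph V) (w X : Sym2 V → ℝ) (y : V → ℝ) : Prop where
  isFracVec : IsFracVec G X
  isCover : IsCover G w y
  isSlackOff : IsSlackOff w X ∅ y

lemma value_domRestrict (hX : support X ⊆ G.edgeSet) (w : Sym2 V → ℝ) :
    value G w (G.edgeSet.domRestrict X) = ∑ e, w e * X e := by
  calc ∑ᶠ e : G.edgeSet, w e * X e
      = ∑ᶠ e ∈ G.edgeSet, w e * X e :=
        finsum_set_coe_eq_finsum_mem (f := fun e => w e * X e) G.edgeSet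
    _ = ∑ᶠ e ∈ Set.univ, w e * X e :=
        finsum_mem_inter_support_eq' _ _ _ fun e he =>
          iff_of_true (hX (right_ne_zero_of_mul he)) trivial
    _ = ∑ᶠ e, w e * X e := finsum_mem_univ _
    _ = ∑ e, w e * X e := finsum_eq_sum_of_fintype _

lemma sum_mul_degree (hX : support X ⊆ G.edgeSet) (y : V → ℝ) :
    ∑ a, y a * degree a X = ∑ e, (e.map y).add * X e := by
  classical
  conv_lhs => rw [pi_eq_sum_univ' X]
  simp only [map_sum, map_smul, smul_eq_mul, mul_sum]
  rw [sum_comm]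
  refine sum_congr rfl fun e _ => ?_
  by_cases he : X e = 0
  · simp [he]
  induction e with | _ p q
  have hpq : p ≠ q := (hX he : G.Adj p q).ne
  simp_rw [degree_single hpq]
  simp [mul_add, add_mul, sum_add_distrib]

lemma sum_eq_value_add (hX : support X ⊆ G.edgeSet) (w : Sym2 V → ℝ) (y : V → ℝ) :
    ∑ a, y a = value G w (G.edgeSet.domRestrict X) +
      (∑ a, y a * (1 - degree a X) + ∑ e, ((e.map y).add - w e) * X e) := by
  simp only [value_domRestrict hX, mul_sub, sub_mul, sum_sub_distrib, mul_one,
    sum_mul_degree hX]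
  ring

lemma IsFracVec.mul_one_sub_degree_nonneg (hX : IsFracVec G X) (hy : IsCover G w y) (a : V) :
    0 ≤ y a * (1 - degree a X) :=
  mul_nonneg (hy.nonneg a) (sub_nonneg.mpr (hX.degree_le a))

lemma IsFracVec.add_sub_mul_nonneg (hX : IsFracVec G X) (hy : IsCover G w y) (e : Sym2 V) :
    0 ≤ ((e.map y).add - w e) * X e := by
  by_cases he : X e = 0
  · rw [he, mul_zero]
  · induction e with | _ a b
    exact mul_nonneg (sub_nonneg.mpr (hy.le_add a b (hX.adj he))) (hX.nonneg _)

lemma IsFracVec.value_le_sum (hX : IsFracVec G X) (hy : IsCover G w y) :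
    value G w (G.edgeSet.domRestrict X) ≤ ∑ a, y a := by
  rw [sum_eq_value_add hX.support_subset w y]
  exact le_add_of_nonneg_right <| add_nonneg
    (sum_nonneg fun a _ => hX.mul_one_sub_degree_nonneg hy a)
    (sum_nonneg fun e _ => hX.add_sub_mul_nonneg hy e)

lemma IsFracVec.value_eq_sum_iff (hX : IsFracVec G X) (hy : IsCover G w y) :
    value G w (G.edgeSet.domRestrict X) = ∑ a, y a ↔ IsSlackOff w X ∅ y := by
  have hV (a : V) (_ : a ∈ univ) := hX.mul_one_sub_degree_nonneg hy a
  have hE (e : Sym2 V) (_ : e ∈ univ) := hX.add_sub_mul_nonneg hy e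
  rw [sum_eq_value_add hX.support_subset w y, left_eq_add,
    add_eq_zero_iff_of_nonneg (sum_nonneg hV) (sum_nonneg hE), sum_eq_zero_iff_of_nonneg hV,
    sum_eq_zero_iff_of_nonneg hE]
  simp only [mem_univ, true_imp_iff, mul_eq_zero, sub_eq_zero, Sym2.forall, Sym2.map_mk,
    Sym2.add_mk]
  refine ⟨fun h => ⟨fun a b hab => ?_, fun a _ ha => ?_⟩, fun h => ⟨fun a => ?_, fun a b => ?_⟩⟩
  · exact ((h.2 a b).resolve_right hab).symm
  · exact ((h.1 a).resolve_left ha).symm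
  · exact or_iff_not_imp_left.mpr fun ha => (h.saturated a (Set.notMem_empty a) ha).symm
  · exact or_iff_not_imp_right.mpr fun hab => (h.tight a b hab).symm

lemma IsOptimalPair.value_eq_sum (h : IsOptimalPair G w X y) :
    value G w (G.edgeSet.domRestrict X) = ∑ a, y a :=
  (h.isFracVec.value_eq_sum_iff h.isCover).mpr h.isSlackOff

lemma IsOptimalPair.isMax (h : IsOptimalPair G w X y) {x : G.edgeSet → ℝ}
    (hx : IsFractionalMatching G x) : value G w x ≤ value G w (G.edgeSet.domRestrict X) := by
  obtain ⟨X', hX', rfl⟩ := exists_domRestrict_edgeSet_eq x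
  rw [h.value_eq_sum]
  exact ((isFractionalMatching_domRestrict_iff hX').mp hx).value_le_sum h.isCover

lemma IsOptimalPair.isBasicMax (h : IsOptimalPair G w X y) (hr : IsRigid X) :
    IsBasicMax G w (G.edgeSet.domRestrict X) :=
  ⟨(isBasic_domRestrict_iff h.isFracVec.support_subset).mpr ⟨h.isFracVec, hr⟩, fun _ => h.isMax⟩

lemma IsOptimalPair.of_value_le {X' : Sym2 V → ℝ} (h : IsOptimalPair G w X y)
    (hX' : IsFracVec G X') (hle : value G w (G.edgeSet.domRestrict X) ≤
      value G w (G.edgeSet.domRestrict X')) : IsOptimalPair G w X' y := by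
  refine ⟨hX', h.isCover, (hX'.value_eq_sum_iff h.isCover).mp ?_⟩
  exact (hX'.value_le_sum h.isCover).antisymm (h.value_eq_sum ▸ hle)

lemma IsOptimalPair.exists_of_isBasicMax (h : IsOptimalPair G w X y) {x : G.edgeSet → ℝ}
    (hx : IsBasicMax G w x) :
    ∃ X', G.edgeSet.domRestrict X' = x ∧ IsRigid X' ∧ IsOptimalPair G w X' y := by
  obtain ⟨X', hX', rfl⟩ := exists_domRestrict_edgeSet_eq x
  obtain ⟨hfrac, hr⟩ := (isBasic_domRestrict_iff hX').mp hx.1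
  exact ⟨X', rfl, hr, h.of_value_le hfrac
    (hx.2 _ ((isFractionalMatching_domRestrict_iff h.isFracVec.support_subset).mpr h.isFracVec))⟩

lemma IsOptimalPair.exists_isRigid (h : IsOptimalPair G w X y) :
    ∃ X', support X' ⊆ support X ∧ IsRigid X' ∧ IsOptimalPair G w X' y := by
  have hle : SimpleGraph.fromEdgeSet (support X) ≤ G :=
    fun a b hab => h.isFracVec.adj (G := G) hab.1
  have hsupp : support X ⊆ (SimpleGraph.fromEdgeSet (support X)).edgeSet := by
    rw [SimpleGraph.edgeSet_fromEdgeSet]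
    exact fun e he => ⟨he, G.not_isDiag_of_mem_edgeSet (h.isFracVec.support_subset he)⟩
  have hH : IsOptimalPair (SimpleGraph.fromEdgeSet (support X)) w X y :=
    ⟨⟨h.isFracVec.nonneg, hsupp, h.isFracVec.degree_le⟩,
      ⟨h.isCover.nonneg, fun a b hab => h.isCover.le_add a b (hle hab)⟩, h.isSlackOff⟩
  obtain ⟨x, hx⟩ := exists_isBasicMax (SimpleGraph.fromEdgeSet (support X)) w
  obtain ⟨X', -, hr, hX'⟩ := hH.exists_of_isBasicMax hx
  refine ⟨X', hX'.isFracVec.support_subset.trans ?_, hr, hX'.isFracVec.mono hle, h.isCover,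
    hX'.isSlackOff⟩
  rw [SimpleGraph.edgeSet_fromEdgeSet]
  exact Set.sdiff_subset

end FractionalMatching

/-! ### Odd cycles -/

section OddCycles

variable {V : Type*} {G : SimpleGraph V}

section Cycles

variable {u : V} {p : G.Walk u u}

lemma exists_ne_mem_edges_of_isCycle (hp : p.IsCycle) {a : V} (ha : a ∈ p.support) :
    ∃ b c, b ≠ c ∧ s(a, b) ∈ p.edges ∧ s(a, c) ∈ p.edges := by
  obtain ⟨b, c, hbc, h⟩ := Set.ncard_eq_two.mp (hp.ncard_neighborSet_toSubgraph_eq_two ha)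
  have hmem (d : V) (hd : d ∈ ({b, c} : Set V)) : s(a, d) ∈ p.edges := by
    rwa [← SimpleGraph.Walk.adj_toSubgraph_iff_mem_edges, ← SimpleGraph.Subgraph.mem_neighborSet, h]
  exact ⟨b, c, hbc, hmem b (by simp), hmem c (by simp)⟩

lemma of_mem_support_of_closed {P : V → Prop} (hP : ∀ a b, s(a, b) ∈ p.edges → P a → P b)
    {a b : V} (ha : a ∈ p.support) (hb : b ∈ p.support) (hPa : P a) : P b := by
  classical
  by_contra hPb
  have hb' : b ∈ (p.rotate a ha).support := (p.mem_support_rotate_iff a ha).mpr hb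
  obtain ⟨d, hd, hfst, hsnd⟩ := ((p.rotate a ha).takeUntil b hb').exists_boundary_dart P hPa hPb
  have hdp : d ∈ p.darts :=
    (p.rotate_darts a ha).mem_iff.mp ((p.rotate a ha).darts_takeUntil_subset_darts hb' hd)
  exact hsnd (hP _ _ (List.mem_map_of_mem hdp) hfst)

lemma card_support_toFinset_of_isCycle [DecidableEq V] (hp : p.IsCycle) :
    #p.support.toFinset = p.length := by
  have htail : p.support.toFinset = p.support.tail.toFinset := by
    ext a
    rw [List.mem_toFinset, List.mem_toFinset, SimpleGraph.Walk.mem_support_iff,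
      or_iff_right_iff_imp]
    rintro rfl
    exact SimpleGraph.Walk.end_mem_tail_support hp.not_nil
  rw [htail, List.toFinset_card_of_nodup hp.support_nodup, List.length_tail,
    SimpleGraph.Walk.length_support, Nat.add_sub_cancel]

lemma not_odd_length_of_two_matchings (hp : p.IsCycle) {f g : V → V}
    (hf : ∀ a ∈ p.support, f (f a) = a) (hfg : ∀ a b, s(a, b) ∈ p.edges → f a = b ∨ g a = b) :
    ¬ Odd p.length := by
  classical
  have hmem (a : V) (ha : a ∈ p.support) : s(a, f a) ∈ p.edges := by
    obtain ⟨b, c, hbc, hb, hc⟩ := exists_ne_mem_edges_of_isCycle hp ha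
    rcases hfg a b hb with rfl | hgb
    · exact hb
    rcases hfg a c hc with rfl | hgc
    · exact hc
    exact absurd (hgb.symm.trans hgc) hbc
  -- `f` pairs up the vertices of the cycle, which has as many vertices as edges.
  have hsum : ∑ _ ∈ p.support.toFinset, (1 : ZMod 2) = 0 :=
    sum_involution (fun a _ => f a) (fun _ _ => by decide)
      (fun a ha _ => (p.adj_of_mem_edges (hmem a (List.mem_toFinset.mp ha))).ne')
      (fun a ha => List.mem_toFinset.mpr
        (p.snd_mem_support_of_mem_edges (hmem a (List.mem_toFinset.mp ha))))
      (fun _ ha => hf _ (List.mem_toFinset.mp ha))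
  rw [sum_const, card_support_toFinset_of_isCycle hp, nsmul_eq_mul, mul_one,
    ZMod.natCast_eq_zero_iff_even] at hsum
  exact Nat.not_odd_iff_even.mpr hsum

end Cycles

/-- The edge sets of the odd cycles on which `X` is constantly `1/2`. They are the cycles in `𝒞(X)`,
without reference to an ambient graph. -/
def oddHalfCycles (X : Sym2 V → ℝ) : Set (Set (Sym2 V)) :=
  {C | (∀ e ∈ C, X e = 1 / 2) ∧
    ∃ (u : V) (p : (⊤ : SimpleGraph V).Walk u u), p.IsCycle ∧ Odd p.length ∧ C = p.edgeSet}

lemma image_oddCycles_domRestrict {X : Sym2 V → ℝ} (hX : support X ⊆ G.edgeSet) :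
    (Subtype.val '' ·) '' oddCycles G (G.edgeSet.domRestrict X) = oddHalfCycles X := by
  ext C
  constructor
  · rintro ⟨C, ⟨hC, u, p, hp, hodd, hCp⟩, rfl⟩
    refine ⟨?_, u, p.mapLe le_top, hp.mapLe le_top, by rwa [SimpleGraph.Walk.length_mapLe], ?_⟩
    · rintro _ ⟨e, he, rfl⟩
      exact hC e he
    · ext e
      simp [hCp]
  · rintro ⟨hC, u, p, hp, hodd, rfl⟩
    have hG (e : Sym2 V) (he : e ∈ p.edges) : e ∈ G.edgeSet := hX (by simp [hC e he])
    have himage : Subtype.val '' (Subtype.val ⁻¹' p.edgeSet : Set G.edgeSet) = p.edgeSet := by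
      rw [Subtype.image_preimage_coe, Set.inter_eq_right]
      exact hG
    refine ⟨Subtype.val ⁻¹' p.edgeSet, ⟨fun e he => hC e he, u, p.transfer G hG, hp.transfer hG,
      ?_, ?_⟩, himage⟩
    · rwa [SimpleGraph.Walk.length_transfer]
    · rw [himage, SimpleGraph.Walk.edges_transfer]
      rfl

lemma ncard_oddCycles_domRestrict {X : Sym2 V → ℝ} (hX : support X ⊆ G.edgeSet) :
    (oddCycles G (G.edgeSet.domRestrict X)).ncard = (oddHalfCycles X).ncard := by
  rw [← image_oddCycles_domRestrict hX,
    Set.ncard_image_of_injective _ (Set.image_injective.mpr Subtype.val_injective)]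

variable [Fintype V] {w X Y : Sym2 V → ℝ} {y : V → ℝ}

lemma exists_isOptimalPair_ncard_eq_gamma (h : IsOptimalPair G w X y) :
    ∃ X', IsRigid X' ∧ IsOptimalPair G w X' y ∧ (oddHalfCycles X').ncard = gamma G w := by
  obtain ⟨x, hx, hcard⟩ := Nat.sInf_mem
    (s := {k | ∃ x, IsBasicMax G w x ∧ k = (oddCycles G x).ncard})
    (let ⟨x, hx⟩ := exists_isBasicMax G w; ⟨_, x, hx, rfl⟩)
  obtain ⟨X', rfl, hr, hX'⟩ := h.exists_of_isBasicMax hx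
  exact ⟨X', hr, hX', (ncard_oddCycles_domRestrict hX'.isFracVec.support_subset).symm.trans
    hcard.symm⟩

lemma gamma_le_ncard_oddHalfCycles (h : IsOptimalPair G w X y) (hr : IsRigid X) :
    gamma G w ≤ (oddHalfCycles X).ncard :=
  Nat.sInf_le ⟨_, h.isBasicMax hr, (ncard_oddCycles_domRestrict h.isFracVec.support_subset).symm⟩

lemma IsFracVec.eq_or_eq_of_eq_half (hX : IsFracVec G X) {a b c d : V} (hbc : b ≠ c)
    (hb : X s(a, b) = 1 / 2) (hc : X s(a, c) = 1 / 2) (hd : X s(a, d) = 1 / 2) :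
    d = b ∨ d = c := by
  classical
  by_contra! h
  have hle : ∑ e ∈ {b, c, d}, X s(a, e) ≤ degree a X := by
    rw [degree_apply]
    exact sum_le_sum_of_subset_of_nonneg (subset_univ _) fun e _ _ => hX.nonneg _
  rw [sum_insert (by simp [hbc, h.1.symm]), sum_insert (by simp [h.2.symm]), sum_singleton, hb, hc,
    hd] at hle
  linarith [hX.degree_le a]

lemma IsFracVec.mem_edges_of_eq_half (hX : IsFracVec G X) {H : SimpleGraph V} {u : V}
    {p : H.Walk u u} (hp : p.IsCycle) (hC : ∀ e ∈ p.edges, X e = 1 / 2) {a b : V}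
    (ha : a ∈ p.support) (hab : X s(a, b) = 1 / 2) : s(a, b) ∈ p.edges := by
  obtain ⟨c, d, hcd, hc, hd⟩ := exists_ne_mem_edges_of_isCycle hp ha
  rcases hX.eq_or_eq_of_eq_half hcd (hC _ hc) (hC _ hd) hab with rfl | rfl
  exacts [hc, hd]

lemma IsFracVec.subset_of_mem_oddHalfCycles (hX : IsFracVec G X) {C D : Set (Sym2 V)}
    (hC : C ∈ oddHalfCycles X) (hD : D ∈ oddHalfCycles X) {e : Sym2 V} (heC : e ∈ C) (heD : e ∈ D) :
    C ⊆ D := by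
  obtain ⟨hC, _, p, -, -, rfl⟩ := hC
  obtain ⟨hD, _, q, hq, -, rfl⟩ := hD
  intro e' he'
  induction e with | _ a b
  induction e' with | _ c d
  have hc : c ∈ q.support := of_mem_support_of_closed (P := (· ∈ q.support))
    (fun x z hxz hx => q.snd_mem_support_of_mem_edges
      (hX.mem_edges_of_eq_half hq hD hx (hC _ hxz)))
    (p.fst_mem_support_of_mem_edges heC) (p.fst_mem_support_of_mem_edges he')
    (q.fst_mem_support_of_mem_edges heD)
  exact hX.mem_edges_of_eq_half hq hD hc (hC _ he')

lemma IsFracVec.ncard_oddHalfCycles_le_add_one (hX : IsFracVec G X) (e : Sym2 V)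
    (h : ∀ C ∈ oddHalfCycles X, e ∉ C → C ∈ oddHalfCycles Y) :
    (oddHalfCycles X).ncard ≤ (oddHalfCycles Y).ncard + 1 := by
  have hone : {C ∈ oddHalfCycles X | e ∈ C}.ncard ≤ 1 :=
    (Set.ncard_le_one (Set.toFinite _)).mpr fun C hC D hD =>
      (hX.subset_of_mem_oddHalfCycles hC.1 hD.1 hC.2 hD.2).antisymm
        (hX.subset_of_mem_oddHalfCycles hD.1 hC.1 hD.2 hC.2)
  have hsub : oddHalfCycles X ⊆ oddHalfCycles Y ∪ {C ∈ oddHalfCycles X | e ∈ C} := by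
    intro C hC
    by_cases he : e ∈ C
    exacts [Or.inr ⟨hC, he⟩, Or.inl (h C hC he)]
  calc (oddHalfCycles X).ncard
      ≤ (oddHalfCycles Y ∪ {C ∈ oddHalfCycles X | e ∈ C}).ncard :=
        Set.ncard_le_ncard hsub (Set.toFinite _)
    _ ≤ (oddHalfCycles Y).ncard + {C ∈ oddHalfCycles X | e ∈ C}.ncard := Set.ncard_union_le _ _
    _ ≤ (oddHalfCycles Y).ncard + 1 := Nat.add_le_add_left hone _

end OddCycles

/-! ### Basic fractional matchings as permutations -/

section Basic

variable {V : Type*} {σ : Equiv.Perm V} {a b : V}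

lemma iterate_apply_apply_ne (ha : σ (σ a) ≠ a) (j : ℕ) : σ (σ (σ^[j] a)) ≠ σ^[j] a := by
  rw [← iterate_succ_apply' σ, ← iterate_succ_apply' σ, iterate_succ_apply, iterate_succ_apply]
  exact fun h => ha (σ.injective.iterate j h)

lemma injOn_orbit_edge (ha : σ (σ a) ≠ a) :
    Set.InjOn (fun j => s(σ^[j] a, σ^[j + 1] a)) (Set.Iio (minimalPeriod σ a)) := by
  intro i hi j hj h
  rcases Sym2.eq_iff.mp h with ⟨hij, -⟩ | ⟨hij, hji⟩
  · exact iterate_injOn_Iio_minimalPeriod hi hj hij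
  · rw [iterate_succ_apply'] at hij hji
    exact absurd (by rw [hji, ← hij]) (iterate_apply_apply_ne ha i)

variable [DecidableEq V]

/-- Half the sum of the edges `{a, σ a}` over the vertices `a` that `σ` moves. A transposition of
`σ` gives an edge of value `1`, a longer cycle a cycle of edges of value `1/2`. -/
noncomputable def halfVec (σ : Equiv.Perm V) : Sym2 V → ℝ :=
  Sym2.lift ⟨fun a b => if a = b then 0 else
    ((if σ a = b then 1 else 0) + if σ b = a then 1 else 0) / 2, fun a b => by
      simp only [eq_comm (a := a), add_comm]⟩

lemma halfVec_mk (σ : Equiv.Perm V) (a b : V) : halfVec σ s(a, b) =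
    if a = b then 0 else ((if σ a = b then 1 else 0) + if σ b = a then 1 else 0) / 2 :=
  rfl

lemma halfVec_nonneg (σ : Equiv.Perm V) (e : Sym2 V) : 0 ≤ halfVec σ e := by
  induction e with | _ a b
  rw [halfVec_mk]
  split_ifs <;> norm_num

lemma halfVec_ne_zero_iff : halfVec σ s(a, b) ≠ 0 ↔ a ≠ b ∧ (σ a = b ∨ σ b = a) := by
  rw [halfVec_mk]
  split_ifs <;> norm_num <;> tauto

lemma halfVec_eq_half (ha : σ (σ a) ≠ a) : halfVec σ s(a, σ a) = 1 / 2 := by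
  have hne : a ≠ σ a := fun h => ha (by rw [← h, ← h])
  simp [halfVec_mk, hne, ha]

lemma degree_halfVec [Fintype V] (σ : Equiv.Perm V) (a : V) :
    degree a (halfVec σ) = if σ a = a then 0 else 1 := by
  have hterm (b : V) : halfVec σ s(a, b) = (if b = σ a then if σ a = a then 0 else 1 / 2 else 0) +
      if b = σ⁻¹ a then if σ a = a then 0 else 1 / 2 else 0 := by
    have hinj : σ b = σ a → b = a := fun h => σ.injective h
    simp only [halfVec_mk, Equiv.Perm.eq_inv_iff_eq]
    split_ifs <;> grind
  rw [degree_apply, sum_congr rfl fun b _ => hterm b, sum_add_distrib]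
  split_ifs <;> norm_num

/-- The alternating sum of the edges of the sequence `p 0, …, p n`. -/
noncomputable def altVec (p : ℕ → V) (n : ℕ) : Sym2 V → ℝ :=
  ∑ j ∈ range n, (-1 : ℝ) ^ j • Pi.single s(p j, p (j + 1)) 1

lemma degree_altVec [Fintype V] {p : ℕ → V} (hp : ∀ j, p j ≠ p (j + 1)) (n : ℕ) (c : V) :
    degree c (altVec p n) = (if c = p 0 then 1 else 0) - (-1) ^ n * if c = p n then 1 else 0 := by
  induction n with
  | zero => simp [altVec]
  | succ n ih =>
    rw [altVec, sum_range_succ, ← altVec, map_add, ih, map_smul, degree_single (hp n), pow_succ,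
      smul_eq_mul]
    ring

lemma exists_of_altVec_ne_zero {p : ℕ → V} {n : ℕ} {e : Sym2 V} (h : altVec p n e ≠ 0) :
    ∃ j < n, e = s(p j, p (j + 1)) := by
  rw [altVec, Finset.sum_apply] at h
  obtain ⟨j, hj, hne⟩ := exists_ne_zero_of_sum_ne_zero h
  refine ⟨j, mem_range.mp hj, ?_⟩
  by_contra he
  simp [he] at hne

lemma altVec_orbit_edge (ha : σ (σ a) ≠ a) {i : ℕ} (hi : i < minimalPeriod σ a) :
    altVec (σ^[·] a) (minimalPeriod σ a) s(σ^[i] a, σ^[i + 1] a) = (-1) ^ i := by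
  rw [altVec, Finset.sum_apply, sum_eq_single_of_mem i (mem_range.mpr hi)]
  · simp
  · intro j hj hji
    rw [Pi.smul_apply, Pi.single_eq_of_ne, smul_zero]
    exact fun h => hji (injOn_orbit_edge ha hi (mem_range.mp hj) h).symm

lemma halfVec_eq_half_of_altVec_ne_zero (ha : σ (σ a) ≠ a) {n : ℕ} {e : Sym2 V}
    (he : altVec (σ^[·] a) n e ≠ 0) : halfVec σ e = 1 / 2 := by
  obtain ⟨j, -, rfl⟩ := exists_of_altVec_ne_zero he
  rw [iterate_succ_apply']
  exact halfVec_eq_half (iterate_apply_apply_ne ha j)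

lemma abs_altVec_orbit_le (ha : σ (σ a) ≠ a) (e : Sym2 V) :
    |altVec (σ^[·] a) (minimalPeriod σ a) e| ≤ 1 := by
  by_cases he : altVec (σ^[·] a) (minimalPeriod σ a) e = 0
  · rw [he, abs_zero]
    exact zero_le_one
  · obtain ⟨j, hj, rfl⟩ := exists_of_altVec_ne_zero he
    rw [altVec_orbit_edge ha hj, abs_pow, abs_neg, abs_one, one_pow]

lemma degree_altVec_orbit [Fintype V] (ha : σ (σ a) ≠ a) (c : V) :
    degree c (altVec (σ^[·] a) (minimalPeriod σ a)) =
      if c = a then 1 - (-1) ^ minimalPeriod σ a else 0 := by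
  have hp (j : ℕ) : σ^[j] a ≠ σ^[j + 1] a := fun h => iterate_apply_apply_ne ha j <| by
    rw [iterate_succ_apply'] at h
    rw [← h, ← h]
  rw [degree_altVec hp, iterate_minimalPeriod, iterate_zero, id_eq]
  split_ifs <;> simp

/-- Otherwise the alternating vector of the orbit would preserve all tight constraints. -/
lemma IsRigid.odd_minimalPeriod [Fintype V] (hr : IsRigid (halfVec σ)) (ha : σ (σ a) ≠ a) :
    Odd (minimalPeriod σ a) := by
  by_contra heven
  rw [Nat.not_odd_iff_even] at heven
  have hzero : altVec (σ^[·] a) (minimalPeriod σ a) = 0 := by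
    refine hr _ (fun e he => ?_) fun c _ => ?_
    · by_contra hne
      rw [halfVec_eq_half_of_altVec_ne_zero ha hne] at he
      norm_num at he
    · rw [degree_altVec_orbit ha, heven.neg_one_pow, sub_self, ite_self]
  have hone := altVec_orbit_edge ha (minimalPeriod_pos_of_mem_periodicPts
    (σ.injective.mem_periodicPts a))
  rw [hzero] at hone
  norm_num at hone

lemma exists_perm_forall_ne_zero_of_mem_doublyStochastic [Fintype V] {M : Matrix V V ℝ}
    (hM : M ∈ doublyStochastic ℝ V) : ∃ σ : Equiv.Perm V, ∀ a, M a (σ a) ≠ 0 := by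
  obtain ⟨l, hl₀, hl₁, rfl⟩ := exists_eq_sum_perm_of_mem_doublyStochastic hM
  obtain ⟨σ, -, hσ⟩ := exists_ne_zero_of_sum_ne_zero (hl₁.trans_ne one_ne_zero)
  refine ⟨σ, fun a => ne_of_gt ?_⟩
  rw [Matrix.sum_apply]
  refine sum_pos' (fun τ _ => ?_) ⟨σ, mem_univ σ, ?_⟩
  · exact mul_nonneg (hl₀ τ) (by
      rw [Equiv.Perm.permMatrix, PEquiv.toMatrix_apply]
      split_ifs <;> norm_num)
  · simpa [PEquiv.toMatrix_apply] using (hl₀ σ).lt_of_ne' hσ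

variable {G : SimpleGraph V} {X : Sym2 V → ℝ}

/-- The loads missing at the vertices, put on the diagonal, make `X` doubly stochastic. -/
lemma IsFracVec.mem_doublyStochastic [Fintype V] (hX : IsFracVec G X) :
    (Matrix.of fun a b => X s(a, b) + if a = b then 1 - degree a X else 0) ∈
      doublyStochastic ℝ V := by
  rw [mem_doublyStochastic_iff_sum]
  refine ⟨fun a b => add_nonneg (hX.nonneg _) ?_, fun a => ?_, fun b => ?_⟩
  · split_ifs
    exacts [sub_nonneg.mpr (hX.degree_le a), le_rfl]
  · simp [sum_add_distrib, ← degree_apply]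
  · simp [sum_add_distrib, Sym2.eq_swap (b := b), ← degree_apply]

lemma IsFracVec.exists_eq_halfVec [Fintype V] (hX : IsFracVec G X) (hr : IsRigid X) :
    ∃ σ : Equiv.Perm V, X = halfVec σ := by
  obtain ⟨σ, hσ⟩ := exists_perm_forall_ne_zero_of_mem_doublyStochastic hX.mem_doublyStochastic
  have hne {a : V} (ha : σ a ≠ a) : X s(a, σ a) ≠ 0 := by simpa [ha.symm] using hσ a
  refine ⟨σ, sub_eq_zero.mp (hr _ (fun e he => ?_) fun a ha => ?_)⟩
  · induction e with | _ a b
    rw [Pi.sub_apply, he, zero_sub, neg_eq_zero]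
    by_contra h
    obtain ⟨hab, rfl | rfl⟩ := halfVec_ne_zero_iff.mp h
    · exact hne hab.symm he
    · exact hne hab (Sym2.eq_swap ▸ he)
  · have hmove : σ a ≠ a := fun h => hσ a <| by
      have hloop : X s(a, a) = 0 := by_contra fun h => (hX.adj h).ne rfl
      simp [h, ha, hloop]
    rw [map_sub, ha, degree_halfVec, if_neg hmove, sub_self]

end Basic

/-! ### Partial complementary slackness and the dual step -/

section DualStep

lemma exists_pos_forall_le_of_pos {ι : Type*} [Finite ι] (f : ι → ℝ) :
    ∃ ε > 0, ∀ i, 0 < f i → ε ≤ f i := by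
  have hev : ∀ᶠ ε in nhdsWithin (0 : ℝ) (Set.Ioi 0), ∀ i, 0 < f i → ε ≤ f i :=
    Filter.eventually_all.mpr fun i => Filter.eventually_imp_distrib_left.mpr fun hi =>
      (eventually_le_nhds hi).filter_mono nhdsWithin_le_nhds
  obtain ⟨ε, hε, h⟩ := (eventually_mem_nhdsWithin.and hev).exists
  exact ⟨ε, hε, h⟩

variable {V : Type*} {G : SimpleGraph V} {w X : Sym2 V → ℝ} {y : V → ℝ} {O : Set V} {ε : ℝ}

lemma isClosed_setOf_isCover (G : SimpleGraph V) (w : Sym2 V → ℝ) :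
    IsClosed {y | IsCover G w y} := by
  have heq : {y | IsCover G w y} =
      {y | (∀ a, 0 ≤ y a) ∧ ∀ a b, G.Adj a b → w s(a, b) ≤ y a + y b} :=
    Set.ext fun y => ⟨fun h => ⟨h.nonneg, h.le_add⟩, fun h => ⟨h.1, h.2⟩⟩
  simp only [heq, Set.ofPred_and, Set.ofPred_forall]
  refine .inter (isClosed_iInter fun a => ?_)
    (isClosed_iInter fun a => isClosed_iInter fun b => isClosed_iInter fun _ => ?_)
  · exact isClosed_le continuous_const (continuous_apply a)
  · exact isClosed_le continuous_const ((continuous_apply a).add (continuous_apply b))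

/-- The edge `{a, b}` of `G` is tight for the cover `y`. -/
def Tight (G : SimpleGraph V) (w : Sym2 V → ℝ) (y : V → ℝ) (a b : V) : Prop :=
  G.Adj a b ∧ w s(a, b) = y a + y b

lemma Tight.symm {a b : V} (h : Tight G w y a b) : Tight G w y b a :=
  ⟨h.1.symm, by rw [Sym2.eq_swap, h.2, add_comm]⟩

open Classical in
/-- The dual step of the Hungarian method: lower `y` by `ε` on `O` and raise it by `ε` on the tight
neighbors of `O`. -/
noncomputable def dualShift (G : SimpleGraph V) (w : Sym2 V → ℝ) (y : V → ℝ) (O : Set V) (ε : ℝ)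
    (a : V) : ℝ :=
  if a ∈ O then y a - ε else if ∃ t ∈ O, Tight G w y t a then y a + ε else y a

lemma dualShift_of_mem {a : V} (ha : a ∈ O) : dualShift G w y O ε a = y a - ε :=
  if_pos ha

lemma dualShift_of_tight {a t : V} (ha : a ∉ O) (ht : t ∈ O) (hta : Tight G w y t a) :
    dualShift G w y O ε a = y a + ε := by
  rw [dualShift, if_neg ha, if_pos ⟨t, ht, hta⟩]

lemma dualShift_of_forall_not_tight {a : V} (ha : a ∉ O) (h : ∀ t ∈ O, ¬ Tight G w y t a) :
    dualShift G w y O ε a = y a := by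
  rw [dualShift, if_neg ha, if_neg fun ⟨t, ht, hta⟩ => h t ht hta]

lemma sub_le_dualShift (hε : 0 ≤ ε) (a : V) : y a - ε ≤ dualShift G w y O ε a := by
  unfold dualShift
  split_ifs <;> linarith

lemma le_dualShift {a : V} (hε : 0 ≤ ε) (ha : a ∉ O) : y a ≤ dualShift G w y O ε a := by
  rw [dualShift, if_neg ha]
  split_ifs <;> linarith

lemma IsCover.dualShift (hy : IsCover G w y) (hε : 0 ≤ ε) (hpos : ∀ t ∈ O, ε ≤ y t)
    (hgap : ∀ a b, 0 < y a + y b - w s(a, b) → 2 * ε ≤ y a + y b - w s(a, b))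
    (hO : ∀ t ∈ O, ∀ a, Tight G w y t a → a ∉ O) : IsCover G w (dualShift G w y O ε) := by
  have hle {a b : V} (hab : G.Adj a b) (ha : a ∈ O) :
      w s(a, b) ≤ WGraph.dualShift G w y O ε a + WGraph.dualShift G w y O ε b := by
    rw [dualShift_of_mem ha]
    rcases (hy.le_add a b hab).eq_or_lt with heq | hlt
    · rw [dualShift_of_tight (hO a ha b ⟨hab, heq⟩) ha ⟨hab, heq⟩]
      linarith
    · have hb := sub_le_dualShift (G := G) (w := w) (y := y) (O := O) hε b
      linarith [hgap a b (sub_pos.mpr hlt)]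
  refine ⟨fun a => ?_, fun a b hab => ?_⟩
  · by_cases ha : a ∈ O
    · rw [dualShift_of_mem ha]
      exact sub_nonneg.mpr (hpos a ha)
    · exact (hy.nonneg a).trans (le_dualShift hε ha)
  · by_cases ha : a ∈ O
    · exact hle hab ha
    by_cases hb : b ∈ O
    · rw [Sym2.eq_swap, add_comm]
      exact hle hab.symm hb
    · exact (hy.le_add a b hab).trans (add_le_add (le_dualShift hε ha) (le_dualShift hε hb))

variable [Fintype V]

lemma isClosed_setOf_isSlackOff (w X : Sym2 V → ℝ) (S : Set V) :
    IsClosed {y | IsSlackOff w X S y} := by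
  have heq : {y | IsSlackOff w X S y} = {y | (∀ a b, X s(a, b) ≠ 0 → w s(a, b) = y a + y b) ∧
      ∀ a ∉ S, degree a X ≠ 1 → y a = 0} :=
    Set.ext fun y => ⟨fun h => ⟨h.tight, fun a ha => not_imp_comm.mp (h.saturated a ha)⟩,
      fun h => ⟨h.1, fun a ha => not_imp_comm.mp (h.2 a ha)⟩⟩
  simp only [heq, Set.ofPred_and, Set.ofPred_forall]
  refine .inter (isClosed_iInter fun a => isClosed_iInter fun b => isClosed_iInter fun _ => ?_)
    (isClosed_iInter fun a => isClosed_iInter fun _ => isClosed_iInter fun _ => ?_)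
  · exact isClosed_eq continuous_const ((continuous_apply a).add (continuous_apply b))
  · exact isClosed_eq (continuous_apply a) continuous_const

lemma IsSlackOff.apply_le_sum_abs {S : Set V} (h : IsSlackOff w X S y) (hy : IsCover G w y)
    {a : V} (ha : a ∉ S) : y a ≤ ∑ e, |w e| := by
  by_cases hya : y a = 0
  · rw [hya]
    exact sum_nonneg fun e _ => abs_nonneg (w e)
  have hdeg : ∑ b, X s(a, b) ≠ 0 := by
    rw [← degree_apply, h.saturated a ha hya]
    exact one_ne_zero
  obtain ⟨b, -, hb⟩ := exists_ne_zero_of_sum_ne_zero hdeg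
  calc y a ≤ y a + y b := le_add_of_nonneg_right (hy.nonneg b)
    _ = w s(a, b) := (h.tight a b hb).symm
    _ ≤ |w s(a, b)| := le_abs_self _
    _ ≤ ∑ e, |w e| := single_le_sum (f := fun e => |w e|) (fun e _ => abs_nonneg _) (mem_univ _)

lemma exists_isMinOn_apply (v : V) (hy : IsCover G w y) (hXy : IsSlackOff w X {v} y) :
    ∃ z, IsCover G w z ∧ IsSlackOff w X {v} z ∧
      ∀ z', IsCover G w z' → IsSlackOff w X {v} z' → z v ≤ z' v := by
  let K := {z | IsCover G w z} ∩ {z | IsSlackOff w X {v} z} ∩ {z | z v ≤ y v}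
  have hclosed : IsClosed K :=
    ((isClosed_setOf_isCover G w).inter (isClosed_setOf_isSlackOff w X {v})).inter
      (isClosed_le (continuous_apply v) continuous_const)
  have hbounded : K ⊆ Set.Icc 0 (fun _ => max (y v) (∑ e, |w e|)) := by
    rintro z ⟨⟨hz, hXz⟩, hzv⟩
    refine ⟨hz.nonneg, fun a => ?_⟩
    by_cases hav : a = v
    · exact le_max_of_le_left (hav ▸ hzv)
    · exact le_max_of_le_right (hXz.apply_le_sum_abs hz hav)
  obtain ⟨z, ⟨⟨hz, hXz⟩, hzv⟩, hmin⟩ :=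
    (isCompact_Icc.of_isClosed_subset hclosed hbounded).exists_isMinOn
      ⟨y, ⟨hy, hXy⟩, le_refl (y v)⟩ (continuous_apply v).continuousOn
  refine ⟨z, hz, hXz, fun z' hz' hXz' => ?_⟩
  rcases le_total (z' v) (y v) with h | h
  · exact hmin ⟨⟨hz', hXz'⟩, h⟩
  · exact hzv.trans h

lemma IsSlackOff.dualShift {S : Set V} (hXy : IsSlackOff w X S y) (hX : IsFracVec G X)
    (hpos : ∀ t ∈ O, y t ≠ 0) (hO : ∀ t ∈ O, ∀ a, Tight G w y t a →
      a ∉ O ∧ degree a X = 1 ∧ ∀ b, X s(a, b) ≠ 0 → b ∈ O) :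
    IsSlackOff w X S (dualShift G w y O ε) := by
  have hsum {a b : V} (hab : X s(a, b) ≠ 0) (ha : a ∈ O) :
      WGraph.dualShift G w y O ε a + WGraph.dualShift G w y O ε b = y a + y b := by
    have htight : Tight G w y a b := ⟨hX.adj hab, hXy.tight a b hab⟩
    rw [dualShift_of_mem ha, dualShift_of_tight (hO a ha b htight).1 ha htight]
    ring
  refine ⟨fun a b hab => ?_, fun a haS hza => ?_⟩
  · have hba : X s(b, a) ≠ 0 := Sym2.eq_swap ▸ hab
    rw [hXy.tight a b hab]
    by_cases ha : a ∈ O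
    · exact (hsum hab ha).symm
    by_cases hb : b ∈ O
    · rw [add_comm, ← hsum hba hb, add_comm]
    rw [dualShift_of_forall_not_tight ha fun t ht hta => hb ((hO t ht a hta).2.2 b hab),
      dualShift_of_forall_not_tight hb fun t ht htb => ha ((hO t ht b htb).2.2 a hba)]
  · by_cases ha : a ∈ O
    · exact hXy.saturated a haS (hpos a ha)
    by_cases hN : ∃ t ∈ O, Tight G w y t a
    · obtain ⟨t, ht, hta⟩ := hN
      exact (hO t ht a hta).2.1
    · rw [dualShift_of_forall_not_tight ha fun t ht hta => hN ⟨t, ht, hta⟩] at hza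
      exact hXy.saturated a haS hza

lemma exists_isCover_isSlackOff_lt {S : Set V} {v : V} (hX : IsFracVec G X) (hy : IsCover G w y)
    (hXy : IsSlackOff w X S y) (hv : v ∈ O) (hpos : ∀ t ∈ O, y t ≠ 0)
    (hO : ∀ t ∈ O, ∀ a, Tight G w y t a → a ∉ O ∧ degree a X = 1 ∧ ∀ b, X s(a, b) ≠ 0 → b ∈ O) :
    ∃ z, IsCover G w z ∧ IsSlackOff w X S z ∧ z v < y v := by
  obtain ⟨ε, hε, hεy⟩ := exists_pos_forall_le_of_pos y
  obtain ⟨δ, hδ, hδs⟩ := exists_pos_forall_le_of_pos fun p : V × V => y p.1 + y p.2 - w s(p.1, p.2)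
  have hmin : 0 < min ε (δ / 2) := lt_min hε (half_pos hδ)
  refine ⟨dualShift G w y O (min ε (δ / 2)), hy.dualShift hmin.le (fun t ht => ?_)
    (fun a b hab => ?_) fun t ht a hta => (hO t ht a hta).1, hXy.dualShift hX hpos hO, ?_⟩
  · exact (min_le_left _ _).trans (hεy t ((hy.nonneg t).lt_of_ne' (hpos t ht)))
  · linarith [hδs (a, b) hab, min_le_right ε (δ / 2)]
  · rw [dualShift_of_mem hv]
    exact sub_lt_self _ hmin

end DualStep

/-! ### Exposing a vertex -/

section Rematching

variable {V : Type*} {G : SimpleGraph V} {w X : Sym2 V → ℝ} {y : V → ℝ} {σ τ : Equiv.Perm V}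
  {t a : V}

/-- `τ` agrees with `σ` on the orbits of `σ` with at least three elements, and rearranges the
remaining vertices into a matching. -/
structure IsRematching (σ τ : Equiv.Perm V) : Prop where
  apply_eq : ∀ a, σ (σ a) ≠ a → τ a = σ a
  involutive : ∀ a, σ (σ a) = a → τ (τ a) = a

lemma IsRematching.refl (σ : Equiv.Perm V) : IsRematching σ σ :=
  ⟨fun _ _ => rfl, fun _ ha => ha⟩

lemma IsRematching.apply_apply_eq_self_iff (h : IsRematching σ τ) : τ (τ a) = a ↔ σ (σ a) = a := by
  refine ⟨fun hτ => ?_, h.involutive a⟩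
  by_contra ha
  have hσa : σ (σ (σ a)) ≠ σ a := fun hσ => ha (σ.injective hσ)
  rw [h.apply_eq a ha, h.apply_eq _ hσa] at hτ
  exact ha hτ

/-- The matching part of `τ` leaves `t` exposed, and apart from `t` only vertices at which the
cover `y` vanishes. All edges used by `τ` are tight. -/
structure IsExposing (G : SimpleGraph V) (w : Sym2 V → ℝ) (y : V → ℝ) (σ τ : Equiv.Perm V)
    (t : V) : Prop where
  isRematching : IsRematching σ τ
  tight : ∀ a, τ a ≠ a → Tight G w y a (τ a)
  apply_eq : τ t = t
  eq_zero : ∀ a ≠ t, τ a = a → y a = 0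

variable [DecidableEq V]

lemma IsRematching.halfVec_eq_half_of_altVec_ne_zero (h : IsRematching σ τ) (ha : σ (σ a) ≠ a)
    {n : ℕ} {e : Sym2 V} (he : altVec (σ^[·] a) n e ≠ 0) : halfVec τ e = 1 / 2 := by
  obtain ⟨j, -, rfl⟩ := exists_of_altVec_ne_zero he
  have hlong := iterate_apply_apply_ne ha j
  rw [iterate_succ_apply', ← h.apply_eq _ hlong]
  exact halfVec_eq_half (h.apply_apply_eq_self_iff.not.mpr hlong)

lemma IsExposing.tight_of_halfVec_ne_zero (h : IsExposing G w y σ τ t) {a b : V}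
    (hab : halfVec τ s(a, b) ≠ 0) : Tight G w y a b := by
  obtain ⟨hne, rfl | rfl⟩ := halfVec_ne_zero_iff.mp hab
  · exact h.tight a hne.symm
  · exact (h.tight b hne).symm

lemma swap_mul_mul_swap_apply (hτa : τ (τ a) = a) (ht : τ t = t) (hne : τ a ≠ a)
    (hta : t ≠ a) (b : V) :
    (Equiv.swap t (τ a) * τ * Equiv.swap t (τ a)) b =
      if b = t then a else if b = a then t else if b = τ a then τ a else τ b := by
  have hτ (c d : V) : τ c = τ d ↔ c = d := τ.injective.eq_iff
  simp only [Equiv.Perm.mul_apply, Equiv.swap_apply_def]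
  grind

/-- The alternating path from `t` through the tight edge `{t, a}` ends in `τ a`. -/
lemma IsExposing.swap (h : IsExposing G w y σ τ t) (hta : Tight G w y t a) (ha : σ (σ a) = a)
    (hτa : τ a ≠ a) :
    IsExposing G w y σ (Equiv.swap t (τ a) * τ * Equiv.swap t (τ a)) (τ a) := by
  have hne : t ≠ a := hta.1.ne
  have hinv := h.isRematching.involutive
  have hpair : τ a ≠ t := fun hat => hne (by rw [← h.apply_eq, ← hat, hinv a ha])
  have hshort {b : V} (hb : τ (τ b) = b) : σ (σ b) = b :=
    h.isRematching.apply_apply_eq_self_iff.mp hb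
  have hτ (b : V) := swap_mul_mul_swap_apply (hinv a ha) h.apply_eq hτa hne b
  refine ⟨⟨fun b hb => ?_, fun b hb => ?_⟩, fun b hb => ?_, ?_, fun b hb hτb => ?_⟩
  · have hbt : b ≠ t := fun hbt => hb (hshort (by rw [hbt, h.apply_eq, h.apply_eq]))
    have hba : b ≠ a := fun hba => hb (hba ▸ ha)
    have hbτ : b ≠ τ a := fun hbτ => hb (hshort (by rw [hbτ, hinv a ha]))
    rw [hτ, if_neg hbt, if_neg hba, if_neg hbτ, h.isRematching.apply_eq b hb]
  · have hswap : τ (τ (Equiv.swap t (τ a) b)) = Equiv.swap t (τ a) b := by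
      rw [Equiv.swap_apply_def]
      split_ifs
      exacts [by rw [hinv a ha], by rw [h.apply_eq, h.apply_eq], hinv b hb]
    simp only [Equiv.Perm.mul_apply, Equiv.swap_apply_self, hswap]
  · rw [hτ] at hb ⊢
    split_ifs with hbt hba hbτ
    · exact hbt ▸ hta
    · exact hba ▸ hta.symm
    · simp [hbτ, hpair, hτa] at hb
    · rw [if_neg hbt, if_neg hba, if_neg hbτ] at hb
      exact h.tight b hb
  · rw [hτ, if_neg hpair, if_neg hτa, if_pos rfl]
  · rw [hτ] at hτb
    split_ifs at hτb with hbt hba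
    · exact absurd (hbt.symm.trans hτb.symm) hne
    · exact absurd (hτb.trans hba) hne
    · exact h.eq_zero b hbt hτb

/-- The matchings reachable from `σ`, which exposes `v`, along alternating paths of tight edges. -/
inductive Reach (G : SimpleGraph V) (w : Sym2 V → ℝ) (y : V → ℝ) (σ : Equiv.Perm V) (v : V) :
    V → Equiv.Perm V → Prop
  | base : Reach G w y σ v v σ
  | step {t a : V} {τ : Equiv.Perm V} (h : Reach G w y σ v t τ) (hta : Tight G w y t a)
      (ha : σ (σ a) = a) (hτa : τ a ≠ a) :
      Reach G w y σ v (τ a) (Equiv.swap t (τ a) * τ * Equiv.swap t (τ a))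

variable {v : V}

lemma Reach.isExposing (h : Reach G w y σ v t τ) (hσ : IsExposing G w y σ σ v) :
    IsExposing G w y σ τ t := by
  induction h with
  | base => exact hσ
  | step _ hta ha hτa ih => exact ih.swap hta ha hτa

lemma Reach.apply_eq_or (h : Reach G w y σ v t τ) (hσ : IsExposing G w y σ σ v) (b : V) :
    τ b = σ b ∨ (∃ ρ, Reach G w y σ v b ρ) ∨ ∃ ρ, Reach G w y σ v (σ b) ρ := by
  induction h with
  | base => exact Or.inl rfl
  | @step t a τ h hta ha hτa ih =>
    have hτ := h.isExposing hσ
    rw [swap_mul_mul_swap_apply (hτ.isRematching.involutive a ha) hτ.apply_eq hτa hta.1.ne]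
    split_ifs with hbt hba hbτ
    · exact Or.inr (Or.inl ⟨τ, hbt ▸ h⟩)
    · refine ih.elim (fun hτb => Or.inr (Or.inr ⟨_, hτb ▸ hba ▸ h.step hta ha hτa⟩)) Or.inr
    · exact Or.inr (Or.inl ⟨_, hbτ ▸ h.step hta ha hτa⟩)
    · exact ih

variable [Fintype V]

lemma isExposing_self_of_isSlackOff (hX : IsFracVec G (halfVec σ))
    (hy : IsSlackOff w (halfVec σ) {v} y) (hv : σ v = v) : IsExposing G w y σ σ v := by
  refine ⟨.refl σ, fun a ha => ?_, hv, fun a hav ha => ?_⟩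
  · have hne : halfVec σ s(a, σ a) ≠ 0 := halfVec_ne_zero_iff.mpr ⟨ha.symm, Or.inl rfl⟩
    exact ⟨hX.adj hne, hy.tight _ _ hne⟩
  · by_contra hya
    have hdeg := hy.saturated a hav hya
    rw [degree_halfVec, if_pos ha] at hdeg
    exact zero_ne_one hdeg

end Rematching

/-! ### Augmentation -/

section Augmentation

variable {V : Type*} [Fintype V] {G : SimpleGraph V} {w X : Sym2 V → ℝ} {y : V → ℝ}
  {σ τ τ₁ τ₂ : Equiv.Perm V} {v t a : V}

lemma isOptimalPair_of_tight (hy : IsCover G w y) (hX : ∀ e, 0 ≤ X e)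
    (htight : ∀ b c, X s(b, c) ≠ 0 → Tight G w y b c) (hle : ∀ c, degree c X ≤ 1)
    (hsat : ∀ c, y c ≠ 0 → degree c X = 1) : IsOptimalPair G w X y where
  isFracVec := ⟨hX, fun e => e.ind fun b c he => (htight b c he).1, hle⟩
  isCover := hy
  isSlackOff := ⟨fun b c h => (htight b c h).2, fun c _ => hsat c⟩

variable [DecidableEq V]

/-- The cover `y` certifies the optimality of a fractional matching supported by two rematchings of
`σ` and one further edge. -/
def HasAugmentation (G : SimpleGraph V) (w : Sym2 V → ℝ) (y : V → ℝ) (σ : Equiv.Perm V) : Prop :=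
  ∃ X e τ₁ τ₂, IsOptimalPair G w X y ∧ IsRematching σ τ₁ ∧ IsRematching σ τ₂ ∧
    ∀ e' ≠ e, X e' ≠ 0 → halfVec τ₁ e' ≠ 0 ∨ halfVec τ₂ e' ≠ 0

lemma IsExposing.degree_halfVec_eq_one (h : IsExposing G w y σ τ t) {c : V} (hct : c ≠ t)
    (hc : y c ≠ 0) : degree c (halfVec τ) = 1 := by
  rw [degree_halfVec, if_neg (mt (h.eq_zero c hct) hc)]

lemma IsExposing.degree_halfVec_eq_zero (h : IsExposing G w y σ τ t) :
    degree t (halfVec τ) = 0 := by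
  rw [degree_halfVec, if_pos h.apply_eq]

lemma degree_halfVec_le_one (σ : Equiv.Perm V) (c : V) : degree c (halfVec σ) ≤ 1 := by
  rw [degree_halfVec]
  split_ifs <;> norm_num

lemma IsExposing.hasAugmentation_of_eq_zero (h : IsExposing G w y σ τ t) (hy : IsCover G w y)
    (ht : y t = 0) : HasAugmentation G w y σ := by
  refine ⟨halfVec τ, s(t, t), τ, τ, isOptimalPair_of_tight hy (halfVec_nonneg τ)
    (fun b c => h.tight_of_halfVec_ne_zero) (degree_halfVec_le_one τ) fun c hc => ?_,
    h.isRematching, h.isRematching, fun e _ he => Or.inl he⟩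
  exact h.degree_halfVec_eq_one (fun hct => hc (hct ▸ ht)) hc

lemma hasAugmentation_of_tight (hy : IsCover G w y) (h₁ : IsExposing G w y σ τ₁ v)
    (h₂ : IsExposing G w y σ τ₂ t) {b c : V} (hbc : Tight G w y b c) (hX : ∀ e, 0 ≤ X e)
    (hsupp : ∀ e ≠ s(b, c), X e ≠ 0 → halfVec τ₁ e ≠ 0 ∨ halfVec τ₂ e ≠ 0)
    (hle : ∀ c, degree c X ≤ 1) (hsat : ∀ c, y c ≠ 0 → degree c X = 1) :
    HasAugmentation G w y σ := by
  refine ⟨X, s(b, c), τ₁, τ₂, isOptimalPair_of_tight hy hX (fun p q hpq => ?_) hle hsat,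
    h₁.isRematching, h₂.isRematching, hsupp⟩
  by_cases he : s(p, q) = s(b, c)
  · rcases Sym2.eq_iff.mp he with ⟨rfl, rfl⟩ | ⟨rfl, rfl⟩
    exacts [hbc, hbc.symm]
  · exact (hsupp _ he hpq).elim h₁.tight_of_halfVec_ne_zero h₂.tight_of_halfVec_ne_zero

lemma IsExposing.hasAugmentation_of_apply_eq_self (h : IsExposing G w y σ τ t)
    (hy : IsCover G w y) (hta : Tight G w y t a) (ha : τ a = a) : HasAugmentation G w y σ := by
  have hdeg (c : V) : degree c (halfVec τ + Pi.single s(t, a) 1) =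
      if τ c = c ∧ c ≠ t ∧ c ≠ a then 0 else 1 := by
    have ht := h.apply_eq
    have hne := hta.1.ne
    rw [map_add, degree_halfVec, degree_single hne]
    split_ifs <;> grind
  refine hasAugmentation_of_tight (X := halfVec τ + Pi.single s(t, a) 1) hy h h hta
    (fun e => ?_) (fun e he hXe => ?_) (fun c => ?_) fun c hc => ?_
  · exact add_nonneg (halfVec_nonneg τ e) (single_one_nonneg _ e)
  · rw [Pi.add_apply, Pi.single_eq_of_ne he, add_zero] at hXe
    exact Or.inl hXe
  · rw [hdeg]
    split_ifs <;> norm_num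
  · rw [hdeg, if_neg fun hτ => hc (h.eq_zero c hτ.2.1 hτ.1)]

lemma IsExposing.hasAugmentation_of_tight_exposed (h₁ : IsExposing G w y σ τ₁ t)
    (h₂ : IsExposing G w y σ τ₂ a) (hy : IsCover G w y) (hta : Tight G w y t a) (ht : y t ≠ 0)
    (ha : y a ≠ 0) : HasAugmentation G w y σ := by
  have hne := hta.1.ne
  have hdeg (c : V) : degree c ((1 / 2 : ℝ) • (halfVec τ₁ + halfVec τ₂ + Pi.single s(t, a) 1)) =
      if c = t ∨ c = a then 1 else (degree c (halfVec τ₁) + degree c (halfVec τ₂)) / 2 := by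
    rw [map_smul, map_add, map_add, degree_single hne, smul_eq_mul]
    by_cases hct : c = t
    · subst hct
      simp [h₁.degree_halfVec_eq_zero, h₂.degree_halfVec_eq_one hne ht, hne]
      norm_num
    by_cases hca : c = a
    · subst hca
      simp [h₂.degree_halfVec_eq_zero, h₁.degree_halfVec_eq_one hne.symm ha, hct]
      norm_num
    · simp [hct, hca]
      ring
  refine hasAugmentation_of_tight hy h₁ h₂ hta
    (X := (1 / 2 : ℝ) • (halfVec τ₁ + halfVec τ₂ + Pi.single s(t, a) 1))
    (fun e => ?_) (fun e he hXe => ?_) (fun c => ?_) fun c hc => ?_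
  · exact mul_nonneg one_half_pos.le (add_nonneg (add_nonneg (halfVec_nonneg τ₁ e)
      (halfVec_nonneg τ₂ e)) (single_one_nonneg _ e))
  · by_contra! hzero
    simp [hzero, he] at hXe
  · rw [hdeg]
    split_ifs
    · exact le_rfl
    · linarith [degree_halfVec_le_one τ₁ c, degree_halfVec_le_one τ₂ c]
  · rw [hdeg]
    split_ifs with hta
    · rfl
    · rw [not_or] at hta
      rw [h₁.degree_halfVec_eq_one hta.1 hc, h₂.degree_halfVec_eq_one hta.2 hc]
      norm_num

/-- The long orbit of `a` is odd, so `σ` minus half its alternating vector covers all of the orbit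
but `a`. -/
lemma IsExposing.hasAugmentation_of_apply_apply_ne (h : IsExposing G w y σ τ t)
    (hy : IsCover G w y) (hr : IsRigid (halfVec σ)) (hta : Tight G w y t a) (ha : σ (σ a) ≠ a) :
    HasAugmentation G w y σ := by
  set D := altVec (σ^[·] a) (minimalPeriod σ a)
  have hhalf (e : Sym2 V) (he : D e ≠ 0) : halfVec τ e = 1 / 2 :=
    h.isRematching.halfVec_eq_half_of_altVec_ne_zero ha he
  have hdeg (c : V) : degree c (halfVec τ - (1 / 2 : ℝ) • D + Pi.single s(t, a) 1) =
      degree c (halfVec τ) + if c = t then 1 else 0 := by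
    rw [map_add, map_sub, map_smul, degree_single hta.1.ne, degree_altVec_orbit ha,
      (hr.odd_minimalPeriod ha).neg_one_pow, smul_eq_mul]
    split_ifs <;> ring
  refine hasAugmentation_of_tight hy h h hta
    (X := halfVec τ - (1 / 2 : ℝ) • D + Pi.single s(t, a) 1)
    (fun e => add_nonneg (sub_nonneg.mpr ?_) (single_one_nonneg _ e))
    (fun e he hXe => Or.inl fun hτe => ?_) (fun c => ?_) fun c hc => ?_
  · by_cases he : D e = 0
    · simpa [he] using halfVec_nonneg τ e
    · rw [hhalf e he, Pi.smul_apply, smul_eq_mul]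
      linarith [(abs_le.mp (abs_altVec_orbit_le ha e)).2]
  · have hDe : D e = 0 := by
      by_contra hDe
      rw [hhalf e hDe] at hτe
      norm_num at hτe
    simp [hτe, hDe, he] at hXe
  · rw [hdeg]
    split_ifs with hct
    · rw [hct, h.degree_halfVec_eq_zero, zero_add]
    · rw [add_zero]
      exact degree_halfVec_le_one τ c
  · rw [hdeg]
    split_ifs with hct
    · rw [hct, h.degree_halfVec_eq_zero, zero_add]
    · rw [h.degree_halfVec_eq_one hct hc, add_zero]

lemma Reach.of_not_hasAugmentation (h : Reach G w y σ v t τ)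
    (hno : ¬ HasAugmentation G w y σ) (hσ : IsExposing G w y σ σ v) (hr : IsRigid (halfVec σ))
    (hy : IsCover G w y) (hta : Tight G w y t a) :
    (¬ ∃ ρ, Reach G w y σ v a ρ) ∧ degree a (halfVec σ) = 1 ∧
      ∀ b, halfVec σ s(a, b) ≠ 0 → ∃ ρ, Reach G w y σ v b ρ := by
  have hexp := h.isExposing hσ
  have hpos {b : V} {ρ : Equiv.Perm V} (hρ : Reach G w y σ v b ρ) : y b ≠ 0 := fun hb =>
    hno ((hρ.isExposing hσ).hasAugmentation_of_eq_zero hy hb)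
  have hshort : σ (σ a) = a := by
    by_contra ha
    exact hno (hexp.hasAugmentation_of_apply_apply_ne hy hr hta ha)
  have hunreached : ¬ ∃ ρ, Reach G w y σ v a ρ := fun ⟨ρ, hρ⟩ =>
    hno (hexp.hasAugmentation_of_tight_exposed (hρ.isExposing hσ) hy hta (hpos h) (hpos hρ))
  have hτa : τ a ≠ a := fun ha => hno (hexp.hasAugmentation_of_apply_eq_self hy hta ha)
  have hmate : ∃ ρ, Reach G w y σ v (σ a) ρ := by
    rcases h.apply_eq_or hσ a with heq | ha | ha
    · exact heq ▸ ⟨_, h.step hta hshort hτa⟩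
    · exact absurd ha hunreached
    · exact ha
  refine ⟨hunreached, ?_, fun b hab => ?_⟩
  · have hne : σ a ≠ a := fun ha => hunreached (by rwa [ha] at hmate)
    rw [degree_halfVec, if_neg hne]
  · obtain ⟨-, rfl | hba⟩ := halfVec_ne_zero_iff.mp hab
    · exact hmate
    · rwa [← σ.injective (hba.trans hshort.symm)] at hmate

lemma hasAugmentation_of_forall_le (hX : IsFracVec G (halfVec σ)) (hr : IsRigid (halfVec σ))
    (hv : σ v = v) (hy : IsCover G w y) (hXy : IsSlackOff w (halfVec σ) {v} y)
    (hmin : ∀ z, IsCover G w z → IsSlackOff w (halfVec σ) {v} z → y v ≤ z v) :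
    HasAugmentation G w y σ := by
  by_contra hno
  have hσ := isExposing_self_of_isSlackOff hX hXy hv
  have hpos : ∀ t ∈ {t | ∃ τ, Reach G w y σ v t τ}, y t ≠ 0 := fun t ⟨τ, hτ⟩ ht =>
    hno ((hτ.isExposing hσ).hasAugmentation_of_eq_zero hy ht)
  obtain ⟨z, hz, hXz, hlt⟩ := exists_isCover_isSlackOff_lt hX hy hXy
    (show v ∈ {t | ∃ τ, Reach G w y σ v t τ} from ⟨σ, .base⟩) hpos
    fun t ⟨τ, hτ⟩ a hta => hτ.of_not_hasAugmentation hno hσ hr hy hta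
  exact (hmin z hz hXz).not_gt hlt

end Augmentation

/-! ### Deleting one vertex -/

section DeleteVertex

variable {V : Type*}

section Transfer

variable [DecidableEq V]

lemma IsRematching.apply_apply_ne_and_halfVec_eq_half {σ τ : Equiv.Perm V}
    (h : IsRematching σ τ) {a b : V} (ha : σ (σ a) ≠ a) (hab : halfVec τ s(a, b) ≠ 0) :
    σ (σ b) ≠ b ∧ halfVec σ s(a, b) = 1 / 2 := by
  have hσa : σ (σ (σ a)) ≠ σ a := fun hσ => ha (σ.injective hσ)
  rcases (halfVec_ne_zero_iff.mp hab).2 with rfl | rfl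
  · rw [h.apply_eq a ha]
    exact ⟨hσa, halfVec_eq_half ha⟩
  · have hb : σ (σ b) ≠ b := fun hb => by
      have hσb : σ (τ b) = b := (h.apply_eq _ ha).symm.trans (h.involutive b hb)
      exact hσa (hσb.symm ▸ hb)
    rw [h.apply_eq b hb, Sym2.eq_swap]
    exact ⟨hb, halfVec_eq_half hb⟩

lemma mem_oddHalfCycles_of_isRematching {σ τ₁ τ₂ : Equiv.Perm V} {X : Sym2 V → ℝ}
    {C : Set (Sym2 V)} (h₁ : IsRematching σ τ₁) (h₂ : IsRematching σ τ₂)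
    (hC : C ∈ oddHalfCycles X) (h : ∀ e ∈ C, halfVec τ₁ e ≠ 0 ∨ halfVec τ₂ e ≠ 0) :
    C ∈ oddHalfCycles (halfVec σ) := by
  obtain ⟨-, u, p, hp, hodd, rfl⟩ := hC
  have hlong (a b : V) (hab : s(a, b) ∈ p.edges) (ha : σ (σ a) ≠ a) :
      σ (σ b) ≠ b ∧ halfVec σ s(a, b) = 1 / 2 :=
    (h _ hab).elim (h₁.apply_apply_ne_and_halfVec_eq_half ha)
      (h₂.apply_apply_ne_and_halfVec_eq_half ha)
  have hu : σ (σ u) ≠ u := by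
    intro hu
    have hshort (a : V) (ha : a ∈ p.support) : σ (σ a) = a := by
      by_contra hne
      exact of_mem_support_of_closed (fun a b hab ha => (hlong a b hab ha).1) ha
        p.start_mem_support hne hu
    have hmatch {τ : Equiv.Perm V} (hτ : IsRematching σ τ) {a b : V} (hb : b ∈ p.support)
        (hab : halfVec τ s(a, b) ≠ 0) : τ a = b := by
      rcases (halfVec_ne_zero_iff.mp hab).2 with hτab | rfl
      exacts [hτab, hτ.involutive b (hshort b hb)]
    refine not_odd_length_of_two_matchings hp (f := τ₁) (g := τ₂)
      (fun a ha => h₁.involutive a (hshort a ha)) (fun a b hab => ?_) hodd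
    have hb := p.snd_mem_support_of_mem_edges hab
    exact (h _ hab).imp (hmatch h₁ hb) (hmatch h₂ hb)
  refine ⟨fun e he => ?_, u, p, hp, hodd, rfl⟩
  induction e with | _ a b
  exact (hlong a b he (of_mem_support_of_closed (P := fun a => σ (σ a) ≠ a)
    (fun a b hab ha => (hlong a b hab ha).1) p.start_mem_support
    (p.fst_mem_support_of_mem_edges he) hu)).2

end Transfer

section OneVertex

variable [Fintype V] {G : SimpleGraph V} {w X : Sym2 V → ℝ} {y : V → ℝ} {v : V}

lemma IsOptimalPair.isCover_isSlackOff_update [DecidableEq V]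
    (h : IsOptimalPair (G.deleteIncidenceSet v) w X y) :
    IsCover G w (update y v (∑ e, |w e|)) ∧
      IsSlackOff w X {v} (update y v (∑ e, |w e|)) := by
  have hle (e : Sym2 V) : w e ≤ ∑ e, |w e| :=
    (le_abs_self _).trans (single_le_sum (f := fun e => |w e|) (fun e _ => abs_nonneg _)
      (mem_univ e))
  have hnonneg (a : V) : 0 ≤ update y v (∑ e, |w e|) a := by
    rw [update_apply]
    split_ifs
    exacts [sum_nonneg fun e _ => abs_nonneg _, h.isCover.nonneg a]
  refine ⟨⟨hnonneg, fun a b hab => ?_⟩, fun a b hab => ?_, fun a ha hya => ?_⟩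
  · by_cases ha : a = v
    · subst ha
      rw [update_self]
      exact (hle _).trans (le_add_of_nonneg_right (hnonneg b))
    by_cases hb : b = v
    · subst hb
      rw [update_self]
      exact (hle _).trans (le_add_of_nonneg_left (hnonneg a))
    rw [update_of_ne ha, update_of_ne hb]
    exact h.isCover.le_add a b (G.deleteIncidenceSet_adj.mpr ⟨hab, ha, hb⟩)
  · obtain ⟨-, ha, hb⟩ := G.deleteIncidenceSet_adj.mp (h.isFracVec.adj hab)
    rw [update_of_ne ha, update_of_ne hb]
    exact h.isSlackOff.tight a b hab
  · rw [update_of_ne ha] at hya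
    exact h.isSlackOff.saturated a (Set.notMem_empty a) hya

lemma IsOptimalPair.exists_ncard_oddHalfCycles_le_add_one
    (h : IsOptimalPair (G.deleteIncidenceSet v) w X y) (hr : IsRigid X) :
    ∃ X' y', IsRigid X' ∧ IsOptimalPair G w X' y' ∧
      (oddHalfCycles X').ncard ≤ (oddHalfCycles X).ncard + 1 := by
  classical
  obtain ⟨σ, rfl⟩ := h.isFracVec.exists_eq_halfVec hr
  have hv : σ v = v := by
    by_contra hne
    have hadj := h.isFracVec.adj (halfVec_ne_zero_iff.mpr ⟨Ne.symm hne, Or.inl rfl⟩)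
    exact (G.deleteIncidenceSet_adj.mp hadj).2.1 rfl
  obtain ⟨hy₀, hXy₀⟩ := h.isCover_isSlackOff_update
  obtain ⟨y', hy', hXy', hmin⟩ := exists_isMinOn_apply v hy₀ hXy₀
  obtain ⟨X', e, τ₁, τ₂, hX', h₁, h₂, hsupp⟩ := hasAugmentation_of_forall_le
    (h.isFracVec.mono (G.deleteIncidenceSet_le v)) hr hv hy' hXy' hmin
  obtain ⟨Y, hYX', hYr, hY⟩ := hX'.exists_isRigid
  refine ⟨Y, y', hYr, hY, hY.isFracVec.ncard_oddHalfCycles_le_add_one e fun C hC he =>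
    mem_oddHalfCycles_of_isRematching h₁ h₂ hC fun e' he' => ?_⟩
  exact hsupp e' (ne_of_mem_of_not_mem he' he) (hYX' (by simp [hC.1 e' he']))

lemma exists_isOptimalPair (G : SimpleGraph V) (w : Sym2 V → ℝ) :
    ∃ X y, IsOptimalPair G w X y := by
  induction G using WellFoundedLT.induction with | _ G ih
  rcases eq_or_ne G ⊥ with rfl | hG
  · exact ⟨0, 0, ⟨fun _ => le_rfl, by simp, by simp⟩, ⟨fun _ => le_rfl, by simp⟩,
      ⟨by simp, by simp⟩⟩
  · obtain ⟨v, b, hvb⟩ := SimpleGraph.ne_bot_iff_exists_adj.mp hG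
    have hlt : G.deleteIncidenceSet v < G := (G.deleteIncidenceSet_le v).lt_of_not_ge
      fun hle => (G.deleteIncidenceSet_adj.mp (hle hvb)).2.1 rfl
    obtain ⟨X, y, h⟩ := ih _ hlt
    obtain ⟨X', -, hr, h'⟩ := h.exists_isRigid
    obtain ⟨Y, z, -, hY, -⟩ := h'.exists_ncard_oddHalfCycles_le_add_one hr
    exact ⟨Y, z, hY⟩

end OneVertex

lemma gamma_le_gamma_deleteIncidenceSet_add_one [Finite V] (G : SimpleGraph V)
    (w : Sym2 V → ℝ) (v : V) : gamma G w ≤ gamma (G.deleteIncidenceSet v) w + 1 := by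
  have := Fintype.ofFinite V
  obtain ⟨X, y, h⟩ := exists_isOptimalPair (G.deleteIncidenceSet v) w
  obtain ⟨X', hr, h', hcard⟩ := exists_isOptimalPair_ncard_eq_gamma h
  obtain ⟨Y, z, hYr, hY, hle⟩ := h'.exists_ncard_oddHalfCycles_le_add_one hr
  exact (gamma_le_ncard_oddHalfCycles hY hYr).trans (hcard ▸ hle)

end DeleteVertex

/-! ### Induced subgraphs -/

section Induced

variable {V : Type*} {U : Set V} {X : Sym2 V → ℝ}

lemma mem_of_apply_ne_zero
    (hX : support X ⊆ Set.range (Sym2.map (Subtype.val : U → V))) {a b : V}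
    (hab : X s(a, b) ≠ 0) : a ∈ U ∧ b ∈ U := by
  obtain ⟨e, he⟩ := hX hab
  induction e with | _ c d
  rcases Sym2.eq_iff.mp he with ⟨rfl, rfl⟩ | ⟨rfl, rfl⟩
  exacts [⟨c.2, d.2⟩, ⟨d.2, c.2⟩]

lemma ncard_oddHalfCycles_le_comp_map [Finite V]
    (hX : support X ⊆ Set.range (Sym2.map (Subtype.val : U → V))) :
    (oddHalfCycles X).ncard ≤ (oddHalfCycles (X ∘ Sym2.map (Subtype.val : U → V))).ncard := by
  refine (Set.ncard_le_ncard ?_ (Set.toFinite _)).trans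
    (Set.ncard_image_le (f := (Sym2.map (Subtype.val : U → V) '' ·)) (Set.toFinite _))
  rintro _ ⟨hC, u, p, hp, hodd, rfl⟩
  have hU : ∀ a ∈ p.support, a ∈ U := fun a ha => by
    obtain ⟨b, -, -, hb, -⟩ := exists_ne_mem_edges_of_isCycle hp ha
    exact (mem_of_apply_ne_zero hX (b := b) (by simp [hC _ hb])).1
  lift u to U using hU u p.start_mem_support
  obtain ⟨q, rfl⟩ : ∃ q : ((⊤ : SimpleGraph V).induce U).Walk u u,
      q.map (SimpleGraph.Embedding.induce U).toHom = p := ⟨p.induce U hU, p.map_induce hU⟩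
  have himage := (q.edgeSet_map (SimpleGraph.Embedding.induce U).toHom).symm
  refine ⟨q.edgeSet, ⟨fun e he => hC _ (himage ▸ Set.mem_image_of_mem _ he), _, q.mapLe le_top,
    hp.of_map.mapLe le_top, ?_, ?_⟩, himage⟩
  · rwa [SimpleGraph.Walk.length_mapLe, ← q.length_map (SimpleGraph.Embedding.induce U).toHom]
  · rw [SimpleGraph.Walk.edgeSet_mapLe_eq_edgeSet]

section Fintype

variable [Fintype V] [Fintype U] {H : SimpleGraph U} {w : Sym2 V → ℝ} {y : V → ℝ}

lemma degree_comp_map (hX : support X ⊆ Set.range (Sym2.map (Subtype.val : U → V))) (a : U) :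
    degree a (X ∘ Sym2.map Subtype.val) = degree (a : V) X := by
  rw [degree_apply, degree_apply]
  refine Fintype.sum_of_injective Subtype.val Subtype.val_injective _ _ (fun b hb => ?_)
    fun b => rfl
  by_contra hab
  exact hb ⟨⟨b, (mem_of_apply_ne_zero hX hab).2⟩, rfl⟩

lemma IsRigid.of_comp_map (hX : support X ⊆ Set.range (Sym2.map (Subtype.val : U → V)))
    (hr : IsRigid (X ∘ Sym2.map (Subtype.val : U → V))) : IsRigid X := by
  intro D hD₀ hD₁
  have hD : support D ⊆ Set.range (Sym2.map (Subtype.val : U → V)) :=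
    fun e he => hX (mt (hD₀ e) he)
  have hzero : D ∘ Sym2.map (Subtype.val : U → V) = 0 := hr _ (fun e => hD₀ _) fun a ha => by
    rw [degree_comp_map hD, hD₁ a (by rwa [← degree_comp_map hX])]
  ext e
  by_contra he
  obtain ⟨e, rfl⟩ := hD he
  exact he (congrFun hzero e)

lemma IsFracVec.of_comp_map (hX : support X ⊆ Set.range (Sym2.map (Subtype.val : U → V)))
    (h : IsFracVec H (X ∘ Sym2.map Subtype.val)) : IsFracVec H.spanningCoe X := by
  refine ⟨fun e => ?_, fun e he => ?_, fun a => ?_⟩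
  · by_cases he : X e = 0
    · exact he.ge
    · obtain ⟨e, rfl⟩ := hX he
      exact h.nonneg e
  · obtain ⟨e, rfl⟩ := hX he
    induction e with | _ a b
    exact ⟨fun hab => (h.adj he).ne (Subtype.ext hab), a, b, h.adj he, rfl, rfl⟩
  · by_cases ha : a ∈ U
    · exact (degree_comp_map hX ⟨a, ha⟩).symm.trans_le (h.degree_le _)
    · rw [degree_apply, sum_eq_zero fun b _ => ?_]
      · exact zero_le_one
      · by_contra hab
        exact ha (mem_of_apply_ne_zero hX hab).1

lemma IsOptimalPair.of_comp_map (hX : support X ⊆ Set.range (Sym2.map (Subtype.val : U → V)))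
    (hy : ∀ a ∉ U, y a = 0)
    (h : IsOptimalPair H (w ∘ Sym2.map Subtype.val) (X ∘ Sym2.map Subtype.val)
      (y ∘ Subtype.val)) : IsOptimalPair H.spanningCoe w X y := by
  refine ⟨.of_comp_map hX h.isFracVec, ⟨fun a => ?_, ?_⟩, fun a b hab => ?_, fun a _ hya => ?_⟩
  · by_cases ha : a ∈ U
    exacts [h.isCover.nonneg ⟨a, ha⟩, (hy a ha).ge]
  · rintro _ _ ⟨-, a, b, hab, rfl, rfl⟩
    exact h.isCover.le_add a b hab
  · obtain ⟨ha, hb⟩ := mem_of_apply_ne_zero hX hab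
    exact h.isSlackOff.tight ⟨a, ha⟩ ⟨b, hb⟩ hab
  · have ha : a ∈ U := by_contra fun ha => hya (hy a ha)
    rw [← h.isSlackOff.saturated ⟨a, ha⟩ (Set.notMem_empty _) hya, degree_comp_map hX]

end Fintype

lemma gamma_spanningCoe_le [Finite V] (H : SimpleGraph U) (w : Sym2 V → ℝ) :
    gamma H.spanningCoe w ≤ gamma H (w ∘ Sym2.map Subtype.val) := by
  have := Fintype.ofFinite V
  have := Fintype.ofFinite U
  obtain ⟨X, y, h⟩ := exists_isOptimalPair H (w ∘ Sym2.map Subtype.val)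
  obtain ⟨X', hr, h', hcard⟩ := exists_isOptimalPair_ncard_eq_gamma h
  obtain ⟨Z, hZ, rfl⟩ : ∃ Z : Sym2 V → ℝ, support Z ⊆ Set.range (Sym2.map (Subtype.val : U → V)) ∧
      Z ∘ Sym2.map Subtype.val = X' :=
    ⟨extend (Sym2.map Subtype.val) X' 0,
      support_extend_zero_subset.trans (Set.image_subset_range _ _),
      extend_comp (Sym2.map.injective Subtype.val_injective) _ _⟩
  obtain ⟨z, hz, rfl⟩ : ∃ z : V → ℝ, (∀ a ∉ U, z a = 0) ∧ z ∘ Subtype.val = y :=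
    ⟨extend Subtype.val y 0, fun a ha => extend_apply' _ _ _ fun ⟨b, hb⟩ => ha (hb ▸ b.2),
      extend_comp Subtype.val_injective _ _⟩
  rw [← hcard]
  exact (gamma_le_ncard_oddHalfCycles (.of_comp_map hZ hz h') (.of_comp_map hZ hr)).trans
    (ncard_oddHalfCycles_le_comp_map hZ)

lemma spanningCoe_induce_compl_insert (G : SimpleGraph V) (v : V) (S : Set V) :
    (G.induce (insert v S)ᶜ).spanningCoe = (G.induce Sᶜ).spanningCoe.deleteIncidenceSet v := by
  ext a b
  simp only [SimpleGraph.deleteIncidenceSet_adj, SimpleGraph.map_adj, SimpleGraph.comap_adj,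
    Embedding.subtype_apply, Subtype.exists, Set.mem_compl_iff, Set.mem_insert_iff, not_or,
    exists_and_left, exists_prop, ↓existsAndEq, and_true, true_and, ne_eq]
  tauto

theorem gamma_le_gamma_spanningCoe_induce_add_card [Finite V] (G : SimpleGraph V)
    (w : Sym2 V → ℝ) (S : Finset V) :
    gamma G w ≤ gamma (G.induce (S : Set V)ᶜ).spanningCoe w + #S := by
  classical
  induction S using Finset.induction_on with
  | empty =>
    rw [coe_empty, Set.compl_empty, SimpleGraph.spanningCoe_induce_univ]
    exact Nat.le_add_right _ _
  | insert v S hv ih =>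
    have hstep := gamma_le_gamma_deleteIncidenceSet_add_one (G.induce (S : Set V)ᶜ).spanningCoe w v
    rw [coe_insert, spanningCoe_induce_compl_insert, card_insert_of_notMem hv]
    omega

theorem gamma_le_gamma_deleteVerts_add_card [Finite V] (G : SimpleGraph V) (w : Sym2 V → ℝ)
    (S : Finset V) : gamma G w ≤ gamma (deleteVerts G S) (deleteWeight w S) + #S :=
  (gamma_le_gamma_spanningCoe_induce_add_card G w S).trans
    (Nat.add_le_add_right (gamma_spanningCoe_le _ w) _)

end Induced

/-! ### Stable graphs -/

section Stable

section Matching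

variable {V : Type*} {G : SimpleGraph V} {M : G.Subgraph} {w : Sym2 V → ℝ}

lemma oddHalfCycles_indicator_one (E : Set (Sym2 V)) : oddHalfCycles (E.indicator 1) = ∅ := by
  classical
  rw [Set.eq_empty_iff_forall_notMem]
  rintro _ ⟨hC, u, p, hp, -, rfl⟩
  obtain ⟨b, -, -, hb, -⟩ := exists_ne_mem_edges_of_isCycle hp p.start_mem_support
  have hhalf := hC _ hb
  rw [Set.indicator_apply] at hhalf
  split_ifs at hhalf <;> norm_num at hhalf

variable [Fintype V]

lemma degree_eq_of_isMatching (hM : M.IsMatching) {a b : V} (hab : M.Adj a b) {D : Sym2 V → ℝ}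
    (hD : support D ⊆ M.edgeSet) : degree a D = D s(a, b) := by
  rw [degree_apply]
  refine sum_eq_single b (fun c _ hcb => ?_) (by simp)
  by_contra hc
  exact hcb (hM.eq_of_adj_left (hD hc) hab)

lemma degree_indicator_of_isMatching (hM : M.IsMatching) {a b : V} (hab : M.Adj a b) :
    degree a (M.edgeSet.indicator 1) = 1 := by
  rw [degree_eq_of_isMatching hM hab Set.support_indicator_subset,
    Set.indicator_of_mem (show s(a, b) ∈ M.edgeSet from hab), Pi.one_apply]

lemma isFracVec_indicator_of_isMatching (hM : M.IsMatching) :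
    IsFracVec G (M.edgeSet.indicator 1) := by
  refine ⟨fun e => Set.indicator_nonneg (fun _ _ => zero_le_one) e,
    Set.support_indicator_subset.trans M.edgeSet_subset, fun a => ?_⟩
  by_cases ha : ∃ b, M.Adj a b
  · obtain ⟨b, hab⟩ := ha
    exact (degree_indicator_of_isMatching hM hab).le
  · rw [degree_apply, sum_eq_zero fun b _ => ?_]
    · exact zero_le_one
    · exact Set.indicator_of_notMem (s := M.edgeSet) (fun hab => ha ⟨b, hab⟩) 1

lemma isRigid_indicator_of_isMatching (hM : M.IsMatching) : IsRigid (M.edgeSet.indicator 1) := by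
  intro D hD₀ hD₁
  have hD : support D ⊆ M.edgeSet := fun e he => by
    by_contra heM
    exact he (hD₀ e (Set.indicator_of_notMem heM _))
  ext e
  by_contra he
  induction e with | _ a b
  have hab : M.Adj a b := hD he
  exact he ((degree_eq_of_isMatching hM hab hD).symm.trans
    (hD₁ a (degree_indicator_of_isMatching hM hab)))

lemma IsOptimalPair.nuF_eq {X : Sym2 V → ℝ} {y : V → ℝ} (h : IsOptimalPair G w X y) :
    nuF G w = value G w (G.edgeSet.domRestrict X) := by
  refine IsGreatest.csSup_eq ⟨⟨_, ?_, rfl⟩, ?_⟩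
  · exact (isFractionalMatching_domRestrict_iff h.isFracVec.support_subset).mpr h.isFracVec
  · rintro _ ⟨x, hx, rfl⟩
    exact h.isMax hx

end Matching

variable {V : Type*} {G : SimpleGraph V} {w : Sym2 V → ℝ}

lemma value_indicator_edgeSet [Finite V] (M : G.Subgraph) (w : Sym2 V → ℝ) :
    value G w (G.edgeSet.domRestrict (M.edgeSet.indicator 1)) = ∑ᶠ e ∈ M.edgeSet, w e := by
  classical
  have := Fintype.ofFinite V
  rw [value_domRestrict (Set.support_indicator_subset.trans M.edgeSet_subset), finsum_mem_def,
    finsum_eq_sum_of_fintype]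
  refine sum_congr rfl fun e _ => ?_
  by_cases he : e ∈ M.edgeSet <;> simp [he]

lemma exists_isMatching_eq_nu [Finite V] (G : SimpleGraph V) (w : Sym2 V → ℝ) :
    ∃ M : G.Subgraph, M.IsMatching ∧ nu G w = ∑ᶠ e ∈ M.edgeSet, w e := by
  have hbot : (⊥ : G.Subgraph).IsMatching := by simp [SimpleGraph.Subgraph.IsMatching]
  refine Set.Nonempty.csSup_mem (s := {r | ∃ M : G.Subgraph, M.IsMatching ∧ r = _})
    ⟨_, ⊥, hbot, rfl⟩ ?_
  refine (Set.finite_range fun M : G.Subgraph => ∑ᶠ e ∈ M.edgeSet, w e).subset ?_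
  rintro _ ⟨M, -, rfl⟩
  exact ⟨M, rfl⟩

lemma gamma_eq_zero_of_isStable [Finite V] (h : IsStable G w) : gamma G w = 0 := by
  have := Fintype.ofFinite V
  obtain ⟨M, hM, hMw⟩ := exists_isMatching_eq_nu G w
  obtain ⟨X, y, hXy⟩ := exists_isOptimalPair G w
  have hle : value G w (G.edgeSet.domRestrict X) ≤
      value G w (G.edgeSet.domRestrict (M.edgeSet.indicator 1)) := by
    rw [value_indicator_edgeSet, ← hMw, ← hXy.nuF_eq]
    exact h.ge
  have hM' := hXy.of_value_le (isFracVec_indicator_of_isMatching hM) hle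
  refine Nat.le_zero.mp ((gamma_le_ncard_oddHalfCycles hM'
    (isRigid_indicator_of_isMatching hM)).trans ?_)
  rw [oddHalfCycles_indicator_one, Set.ncard_empty]

end Stable

end WGraph

theorem mainTheorem4_general {V : Type*} [Finite V] (G : SimpleGraph V) (w : Sym2 V → ℝ) :
    (∀ v : V, (WGraph.gamma (WGraph.deleteVerts G {v}) (WGraph.deleteWeight w {v}) : ℤ) ≥
      (WGraph.gamma G w : ℤ) - 1) ∧
    ∀ S : Finset V, WGraph.IsVertexStabilizer G w (S : Set V) →
      S.card ≥ WGraph.gamma G w := by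
  refine ⟨fun v => ?_, fun S hS => ?_⟩
  · have hv := WGraph.gamma_le_gamma_deleteVerts_add_card G w {v}
    rw [Finset.coe_singleton, Finset.card_singleton] at hv
    omega
  · have hle := WGraph.gamma_le_gamma_deleteVerts_add_card G w S
    rwa [WGraph.gamma_eq_zero_of_isStable hS, zero_add] at hle

theorem mainTheorem4 {V : Type*} [Finite V] (G : SimpleGraph V) (w : Sym2 V → ℝ)
    (hw : ∀ e ∈ G.edgeSet, 0 ≤ w e) :
    (∀ v : V, (WGraph.gamma (WGraph.deleteVerts G {v}) (WGraph.deleteWeight w {v}) : ℤ) ≥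
      (WGraph.gamma G w : ℤ) - 1) ∧
    ∀ S : Finset V, WGraph.IsVertexStabilizer G w (S : Set V) →
      S.card ≥ WGraph.gamma G w :=
  mainTheorem4_general G w
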